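/- Fix $L>0$, $\omega_0>0$, $\alpha\ge 0$ and $f\in C^2(\mathbb R)$, and put $\omega_1=\omega_0L$. Let $X,V\in C^4(\mathbb R)$ be $L$-periodic with $X>0$, $\int_0^LX=L$, $\int_0^LV=0$, let $C_1,C_2>0$, $0<\delta<1$, $c_1=L\int_0^L|X''|$, $c_2=L\int_0^L|V''|$, and assume $$\Bigl(1+\frac{\alpha}{8\omega_0}\Bigr)\Bigl(2c_1+\frac{C_1}{L}\Bigr)+\frac{1}{4\omega_0}\Bigl(2c_2+\frac{C_2}{L}\Bigr)<\delta .$$ Let $v\in\mathbb R$. For all sufficiently large $N$ let $x^{(N)}_k(t)$, $k\in\mathbb Z$, $t\ge 0$, satisfy $x^{(N)}_{k+N}(t)=x^{(N)}_k(t)+L$ and $$\ddot x^{(N)}_k=(\omega_0N)^2\bigl(x^{(N)}_{k+1}-2x^{(N)}_k+x^{(N)}_{k-1}\bigr)-\alpha\dot x^{(N)}_k+f(t),$$ with initial data $x^{(N)}_0(0)=0$, $x^{(N)}_k(0)<x^{(N)}_{k+1}(0)$, $\dot x^{(N)}_0(0)=v$ and, for all $k$, $$\Bigl|x^{(N)}_{k+1}(0)-x^{(N)}_k(0)-\tfrac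 LNX\bigl(\tfrac{kL}N\bigr)\Bigr|<\frac{C_1}{N^2},\qquad \Bigl|\dot x^{(N)}_{k+1}(0)-\dot x^{(N)}_k(0)-\tfrac LNV\bigl(\tfrac{kL}N\bigr)\Bigr|<\frac{C_2}{N^2}.$$ For $x\in\mathbb R$ let $k(x,N)$ be the unique integer with $x^{(N)}_{k(x,N)}(0)\le x<x^{(N)}_{k(x,N)+1}(0)$ ($N$ large), and let $z(x)$ be the unique real number with $\int_0^{z(x)}X(u)\,du=x$. There is a unique function $G\in C^2([0,\infty)\times\mathbb R)$ with $$G_{tt}=\omega_1^2G_{zz}-\alpha G_t+f(t),\quad G(0,z)=\int_0^zX,\quad G_t(0,z)=v+\int_0^zV,\quad G(t,z+L)=G(t,z)+L .$$ It is given by $G(t,z)=G(t,0)+z+\int_0^zr(t,y)\,dy$ and $$G(t,0)=\kappa(t)v+\int_0^t\kappa(t-s)f(s)\,ds+\omega_1^2\int_0^t\kappa(t-s)\,r_x(s,0)\,ds .$$ Here $\kappa(\tau)=(1-e^{-\alpha\tau})/\alpha$ ($\kappa(\tau)=\tau$ if $\alpha=0$) and $$r(t,x)=\sum_{n\in\mathbb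 Z,\,n\ne0}e^{-i\lambda_nx}\Bigl(\hat X_n\bigl(a_n(t)+\tfrac{\alpha}{2}b_n(t)\bigr)+\hat V_nb_n(t)\Bigr)$$ (an unconditionally convergent series), where $\lambda_n=2\pi n/L$, $\hat h_n=\frac1L\int_0^Le^{i\lambda_nu}h(u)\,du$, $D_n=\frac{\alpha^2}4-\lambda_n^2\omega_1^2$, $\nu_n=\sqrt{|D_n|}$, and $a_n(t)=e^{-\alpha t/2}\cosh(\nu_nt)$ if $D_n\ge0$, $a_n(t)=e^{-\alpha t/2}\cos(\nu_nt)$ if $D_n<0$, while $b_n(t)$ equals $e^{-\alpha t/2}\sinh(\nu_nt)/\nu_n$, $e^{-\alpha t/2}\sin(\nu_nt)/\nu_n$ or $e^{-\alpha t/2}t$ according as $D_n>0$, $D_n<0$ or $D_n=0$. Moreover, for every $T>0$, as $N\to\infty$: 1) $x^{(N)}_{\lfloor zN/L\rfloor}(t)\to G(t,z)$ uniformly in $t\in[0,T]$ and $z\in[0,L)$; 2) $x^{(N)}_{k(x,N)}(t)\to G(t,z(x))$ uniformly in $t\in[0,T]$ and $x\in[0,L)$. -/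

import Mathlib

open Set Filter Topology MeasureTheory

noncomputable section

namespace StringChain

/-- A spatially periodic motion of the harmonic chain with `N` particles per period `L`, for times
`t ≥ 0`: `x k t` is the position and `xdot k t` the velocity of particle `k : ℤ`, and Newton's
equations with stiffness `ω ^ 2`, damping `α` and common driving force `f` hold
(one-sided derivatives at `t = 0`). -/
structure IsMotion (L ω α : ℝ) (f : ℝ → ℝ) (N : ℕ) (x xdot : ℤ → ℝ → ℝ) : Prop where
  periodic : ∀ k : ℤ, ∀ t : ℝ, 0 ≤ t → x (k + N) t = x k t + L
  velocity : ∀ k : ℤ, ∀ t : ℝ, 0 ≤ t → HasDerivWithinAt (x k) (xdot k t) (Ici 0) t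
  newton : ∀ k : ℤ, ∀ t : ℝ, 0 ≤ t →
    HasDerivWithinAt (xdot k)
      (ω ^ 2 * (x (k + 1) t - 2 * x k t + x (k - 1) t) - α * xdot k t + f t) (Ici 0) t

/-- Admissible profiles: `X` and `V` are `L`-periodic and `C⁴`, `X > 0`,
and over one period `X` has integral `L` and `V` has integral `0`. -/
structure IsProfile (L : ℝ) (X V : ℝ → ℝ) : Prop where
  contDiff_X : ContDiff ℝ 4 X
  contDiff_V : ContDiff ℝ 4 V
  periodic_X : Function.Periodic X L
  periodic_V : Function.Periodic V L
  pos : ∀ u, 0 < X u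
  integral_X : ∫ u in (0 : ℝ)..L, X u = L
  integral_V : ∫ u in (0 : ℝ)..L, V u = 0

/-- The initial data `x0 k`, `v0 k` (positions and velocities) of the `N`-particle chain are
ordered, start at the origin, and follow the profiles `X`, `V` up to errors
`C₁ / N ^ 2`, `C₂ / N ^ 2`. -/
structure FollowsProfile (L : ℝ) (X V : ℝ → ℝ) (C₁ C₂ : ℝ) (N : ℕ) (x0 v0 : ℤ → ℝ) : Prop where
  origin : x0 0 = 0
  ordered : ∀ k : ℤ, x0 k < x0 (k + 1)
  position : ∀ k : ℤ, |x0 (k + 1) - x0 k - L / N * X (k * L / N)| < C₁ / (N : ℝ) ^ 2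
  velocity : ∀ k : ℤ, |v0 (k + 1) - v0 k - L / N * V (k * L / N)| < C₂ / (N : ℝ) ^ 2

/-- `L ∫₀ᴸ |h''|`. -/
def fluctuation (L : ℝ) (h : ℝ → ℝ) : ℝ :=
  L * ∫ u in (0 : ℝ)..L, |iteratedDeriv 2 h u|

/-- The constant `γ` of the regularity condition `γ < δ`. -/
def gammaConst (L ω₀ α : ℝ) (X V : ℝ → ℝ) (C₁ C₂ : ℝ) : ℝ :=
  (1 + α / (8 * ω₀)) * (2 * fluctuation L X + C₁ / L)
    + (2 * fluctuation L V + C₂ / L) / (4 * ω₀)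

/-- `G` is a classical solution, `C²` on `[0, ∞) × ℝ`, of
`G_tt = ω₁² G_zz - α G_t + f(t)` with `G(0,z) = ∫₀ᶻ X`, `G_t(0,z) = v + ∫₀ᶻ V` and
`G(t, z + L) = G(t, z) + L`. -/
structure IsWaveSolution (L ω₁ α : ℝ) (f X V : ℝ → ℝ) (v : ℝ) (G : ℝ → ℝ → ℝ) : Prop where
  contDiffOn : ContDiffOn ℝ 2 (fun p : ℝ × ℝ => G p.1 p.2) (Ici 0 ×ˢ univ)
  wave : ∀ t : ℝ, 0 ≤ t → ∀ z : ℝ,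
    iteratedDerivWithin 2 (fun s => G s z) (Ici 0) t
      = ω₁ ^ 2 * iteratedDeriv 2 (fun w => G t w) z
        - α * derivWithin (fun s => G s z) (Ici 0) t + f t
  initial_position : ∀ z : ℝ, G 0 z = ∫ u in (0 : ℝ)..z, X u
  initial_velocity : ∀ z : ℝ,
    derivWithin (fun s => G s z) (Ici 0) 0 = v + ∫ u in (0 : ℝ)..z, V u
  quasiperiodic : ∀ t : ℝ, 0 ≤ t → ∀ z : ℝ, G t (z + L) = G t z + L

/-- The wave number `λₙ = 2πn / L`. -/
def waveNumber (L : ℝ) (n : ℤ) : ℝ := 2 * Real.pi * n / L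

/-- `α² / 4 - λₙ² ω₁²`. -/
def disc (L ω₁ α : ℝ) (n : ℤ) : ℝ := α ^ 2 / 4 - waveNumber L n ^ 2 * ω₁ ^ 2

/-- `νₙ = √|λₙ² ω₁² - α² / 4|`. -/
def freq (L ω₁ α : ℝ) (n : ℤ) : ℝ := Real.sqrt |disc L ω₁ α n|

/-- The mode function `ãₙ(t)`. -/
def modeA (L ω₁ α : ℝ) (n : ℤ) (t : ℝ) : ℝ :=
  Real.exp (-α * t / 2) *
    if 0 ≤ disc L ω₁ α n then Real.cosh (freq L ω₁ α n * t) else Real.cos (freq L ω₁ α n * t)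

/-- The mode function `b̃ₙ(t)`. -/
def modeB (L ω₁ α : ℝ) (n : ℤ) (t : ℝ) : ℝ :=
  Real.exp (-α * t / 2) *
    if 0 < disc L ω₁ α n then Real.sinh (freq L ω₁ α n * t) / freq L ω₁ α n
    else if disc L ω₁ α n < 0 then Real.sin (freq L ω₁ α n * t) / freq L ω₁ α n
    else t

/-- The Fourier coefficient `(1/L) ∫₀ᴸ exp(i λₙ u) h(u) du`. -/
def fourierCoef (L : ℝ) (h : ℝ → ℝ) (n : ℤ) : ℂ :=
  (1 / L : ℂ) * ∫ u in (0 : ℝ)..L, Complex.exp (Complex.I * (waveNumber L n * u : ℝ)) * (h u : ℂ)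

/-- The `n`-th term of the Fourier series, over `n ≠ 0`, of `r(t, x)`. -/
def deviationTerm (L ω₁ α : ℝ) (X V : ℝ → ℝ) (t x : ℝ) (n : ℤ) : ℂ :=
  if n = 0 then 0 else
    Complex.exp (-Complex.I * (waveNumber L n * x : ℝ)) *
      (fourierCoef L X n * (modeA L ω₁ α n t + α * modeB L ω₁ α n t / 2 : ℝ)
        + fourierCoef L V n * (modeB L ω₁ α n t : ℝ))

/-- `(1 - exp(-α τ)) / α`, read as its limit `τ` when `α = 0`. -/
def dampingKernel (α τ : ℝ) : ℝ := if α = 0 then τ else (1 - Real.exp (-α * τ)) / α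

end StringChain

end

noncomputable section

namespace StringChain

/-! The convergence is stability plus consistency for the chain viewed as a space discretisation of
the wave equation. If `G` solves the wave equation, the error `e_k(t) = x_k(t) - G(t, kL/N)` obeys
the chain equation with `f` replaced by the defect between the second difference of `G` and `(L/N)²
G_zz`. Since `(ω₀N)² (L/N)² = (ω₀L)²` and `G_zz` is uniformly continuous on compact sets, this
defect tends to zero (`abs_secondDiff_sub_le`). A Grönwall estimate for the mean energy
(`chainEnergy_le`) propagates the smallness of the initial error. A discrete Sobolev inequality
(`abs_le_of_chainEnergy`) turns it into a bound on `|e_k|` with constants independent of `N`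
(`chain_error_le`).

This works for every `C²` solution, so two solutions are limits of the same chains and coincide:
uniqueness needs no separate argument for the PDE.

Existence is by Fourier series. Each mode is a damped oscillator, and `C⁴` profiles have
coefficients summable against `(1 + |λₙ|)²`, enough for two derivatives term by term. Write `W(t,z)
= ∫₀ᶻ r(t,y) dy`. It solves the unforced equation up to the term `-ω₁² r_x(t,0)`. Adding a function
`g(t)` with `g'' = -α g' + f + ω₁² r_x(t,0)` repairs this, and Duhamel's formula for `g` is the
stated expression for `G(t,0)`.

For labels given by initial position, `z ↦ ∫₀ᶻ X` has slope at least `m > 0`. Closeness of positions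
at time `0` therefore forces closeness of `k(x,N) L/N` and `z(x)`. -/

/-! ### Energy estimates for the periodic chain. -/

theorem sum_range_add_one_of_periodic {F : ℤ → ℝ} {N : ℕ} (hF : Function.Periodic F (N : ℤ)) :
    ∑ k ∈ Finset.range N, F ((k : ℤ) + 1) = ∑ k ∈ Finset.range N, F k := by
  have h1 := Finset.sum_range_succ (fun k : ℕ => F k) N
  have h2 := Finset.sum_range_succ' (fun k : ℕ => F k) N
  have h3 : F N = F 0 := by simpa using hF 0
  push_cast at h1 h2
  linarith

theorem exists_range_eq_of_periodic {N : ℕ} (hN : 0 < N) (k : ℤ) :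
    ∃ j ∈ Finset.range N, ∀ F : ℤ → ℝ, Function.Periodic F (N : ℤ) → F k = F j := by
  have hN' : (0 : ℤ) < N := by exact_mod_cast hN
  have h0 := Int.emod_nonneg k hN'.ne'
  have h1 := Int.emod_lt_of_pos k hN'
  refine ⟨(k % N).toNat, by rw [Finset.mem_range]; omega, fun F hF => ?_⟩
  rw [Int.toNat_of_nonneg h0, Int.emod_def, mul_comm, ← smul_eq_mul, hF.sub_zsmul_eq]

/-- The energy of a displacement `e` with velocity `e'` of the chain with stiffness `c ^ 2`,
together with its mean square. -/
def chainEnergy (c : ℝ) (N : ℕ) (e e' : ℤ → ℝ) : ℝ :=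
  (∑ k ∈ Finset.range N, (e k ^ 2 + e' k ^ 2 + c ^ 2 * (e (k + 1) - e k) ^ 2)) / N

theorem chainEnergy_nonneg (c : ℝ) (N : ℕ) (e e' : ℤ → ℝ) : 0 ≤ chainEnergy c N e e' := by
  unfold chainEnergy
  positivity

theorem abs_sub_le_sum_abs {e : ℤ → ℝ} {N j : ℕ} (hj : j ≤ N) :
    |e j - e 0| ≤ ∑ k ∈ Finset.range N, |e (k + 1) - e k| := by
  have h := Finset.sum_range_sub (fun k : ℕ => e k) j
  push_cast at h
  rw [← h]
  refine (Finset.abs_sum_le_sum_abs _ _).trans ?_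
  exact Finset.sum_le_sum_of_subset_of_nonneg (Finset.range_mono hj) fun _ _ _ => abs_nonneg _

/-- A discrete Sobolev inequality. The mean square bounds `|e|` at one site, and the elastic part
bounds the total variation over a period. The stiffness `ω N` is what makes the bound independent of
`N`. -/
theorem abs_le_of_chainEnergy {ω : ℝ} (hω : 0 < ω) {N : ℕ} (hN : 0 < N) {e : ℤ → ℝ} (e' : ℤ → ℝ)
    (he : Function.Periodic e (N : ℤ)) (k : ℤ) :
    |e k| ≤ √(chainEnergy (ω * N) N e e') * (1 + 2 / ω) := by
  set E := chainEnergy (ω * N) N e e' with hE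
  have hN' : (0 : ℝ) < N := by exact_mod_cast hN
  have hsum : ∑ k ∈ Finset.range N, (e k ^ 2 + e' k ^ 2 + (ω * N) ^ 2 * (e (k + 1) - e k) ^ 2)
      = N * E := by
    rw [hE, chainEnergy]; field_simp
  have hE0 : 0 ≤ E := chainEnergy_nonneg _ _ _ _
  -- Cauchy–Schwarz loses a factor `√N`, which cancels because `(ωN)² ∑ (Δe)² ≤ N E`.
  have hS : ∑ k ∈ Finset.range N, |e (k + 1) - e k| ≤ √E / ω := by
    have h1 := sq_sum_le_card_mul_sum_sq (s := Finset.range N)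
      (f := fun k : ℕ => |e ((k : ℤ) + 1) - e k|)
    simp only [Finset.card_range, sq_abs] at h1
    have h2 : (ω * N) ^ 2 * ∑ k ∈ Finset.range N, (e ((k : ℤ) + 1) - e k) ^ 2 ≤ N * E := by
      rw [← hsum, Finset.mul_sum]
      refine Finset.sum_le_sum fun i _ => ?_
      nlinarith [sq_nonneg (e i), sq_nonneg (e' i)]
    rw [le_div_iff₀ hω]
    apply Real.le_sqrt_of_sq_le
    rw [mul_pow]
    have h3 : N ^ 2 * (ω ^ 2 * ∑ k ∈ Finset.range N, (e ((k : ℤ) + 1) - e k) ^ 2) ≤ N * E := by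
      rw [← mul_assoc, ← mul_pow, mul_comm (N : ℝ)]; exact h2
    have h4 : N * (ω ^ 2 * ∑ k ∈ Finset.range N, (e ((k : ℤ) + 1) - e k) ^ 2) ≤ E := by
      refine le_of_mul_le_mul_left ?_ hN'
      rw [← mul_assoc, ← sq]; exact h3
    nlinarith [mul_le_mul_of_nonneg_right h1 (sq_nonneg ω)]
  obtain ⟨j, hj, hjE⟩ : ∃ j ∈ Finset.range N, e j ^ 2 ≤ E := by
    apply Finset.exists_le_of_sum_le (Finset.nonempty_range_iff.2 hN.ne')
    rw [Finset.sum_const, Finset.card_range, nsmul_eq_mul, ← hsum]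
    refine Finset.sum_le_sum fun i _ => ?_
    nlinarith [sq_nonneg (e' i), sq_nonneg (ω * N * (e (i + 1) - e i))]
  obtain ⟨i, hi, hki⟩ := exists_range_eq_of_periodic hN k
  rw [hki e he]
  have h1 := (abs_sub_le_sum_abs (e := e) (Finset.mem_range.1 hi).le).trans hS
  have h2 := (abs_sub_le_sum_abs (e := e) (Finset.mem_range.1 hj).le).trans hS
  have h3 : |e j| ≤ √E := Real.abs_le_sqrt hjE
  -- Two variations are paid for, from the given site to site `0` and from there to the site where
  -- `|e|` is at most `√E`.
  have : √E * (1 + 2 / ω) = √E + √E / ω + √E / ω := by ring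
  rw [this]
  rw [abs_le] at *
  constructor <;> linarith

/-- Summation by parts: the work of the elastic forces cancels the change of elastic energy, with no
boundary term by periodicity. Only damping, the forcing `τ` and the mean-square term remain. -/
theorem HasDerivWithinAt.chainEnergy {c α : ℝ} {N : ℕ} {e e' τ : ℤ → ℝ → ℝ} {t : ℝ}
    {s : Set ℝ} (he : Function.Periodic (fun k => e k t) (N : ℤ))
    (he' : Function.Periodic (fun k => e' k t) (N : ℤ))
    (hd : ∀ k, HasDerivWithinAt (e k) (e' k t) s t)
    (hd' : ∀ k, HasDerivWithinAt (e' k)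
      (c ^ 2 * (e (k + 1) t - 2 * e k t + e (k - 1) t) - α * e' k t + τ k t) s t) :
    HasDerivWithinAt (fun t => chainEnergy c N (fun k => e k t) (fun k => e' k t))
      ((∑ k ∈ Finset.range N,
        (2 * (e k t * e' k t) - 2 * α * e' k t ^ 2 + 2 * (e' k t * τ k t))) / N) s t := by
  have key : HasDerivWithinAt
      (fun t => StringChain.chainEnergy c N (fun k => e k t) (fun k => e' k t))
      ((∑ k ∈ Finset.range N, (2 * e k t * e' k t + 2 * e' k t *
        (c ^ 2 * (e (k + 1) t - 2 * e k t + e (k - 1) t) - α * e' k t + τ k t)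
        + c ^ 2 * (2 * (e (k + 1) t - e k t) * (e' (k + 1) t - e' k t)))) / N) s t := by
    unfold StringChain.chainEnergy
    refine HasDerivWithinAt.div_const (HasDerivWithinAt.fun_sum fun k _ => ?_) _
    have h1 := (hd k).fun_pow 2
    have h2 := (hd' k).fun_pow 2
    have h3 := (((hd (k + 1)).fun_sub (hd k)).fun_pow 2).const_mul (c ^ 2)
    refine ((h1.fun_add h2).fun_add h3).congr_deriv ?_
    simp
  convert key using 2
  have hshift := sum_range_add_one_of_periodic (N := N)
    (F := fun k => e' k t * (e k t - e (k - 1) t)) (fun k => by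
      have h1 := he k
      have h2 := he' k
      have h3 := he (k - 1)
      simp only at h1 h2 h3 ⊢
      rw [h1, h2, show k + (N : ℤ) - 1 = k - 1 + N by ring, h3])
  simp only [add_sub_cancel_right] at hshift
  rw [← sub_eq_zero, ← Finset.sum_sub_distrib]
  have : ∀ k ∈ Finset.range N, (2 * (e k t * e' k t) - 2 * α * e' k t ^ 2 + 2 * (e' k t * τ k t))
      - (2 * e k t * e' k t + 2 * e' k t *
        (c ^ 2 * (e (k + 1) t - 2 * e k t + e (k - 1) t) - α * e' k t + τ k t)
        + c ^ 2 * (2 * (e (k + 1) t - e k t) * (e' (k + 1) t - e' k t)))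
      = 2 * c ^ 2 * (e' k t * (e k t - e (k - 1) t)
        - e' (k + 1) t * (e (k + 1) t - e k t)) := fun k _ => by ring
  rw [Finset.sum_congr rfl this, ← Finset.mul_sum, Finset.sum_sub_distrib, hshift]
  simp

/-- Grönwall's inequality. Damping has the favourable sign, and Young's inequality on `2 e e'` and
`2 e' τ` gives `E' ≤ 2E + η²`, so `exp(-2t) (E + η²/2)` decreases. -/
theorem chainEnergy_le {c α T η : ℝ} (hα : 0 ≤ α) {N : ℕ} (hN : 0 < N)
    {e e' τ : ℤ → ℝ → ℝ} (he : ∀ t, 0 ≤ t → Function.Periodic (fun k => e k t) (N : ℤ))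
    (he' : ∀ t, 0 ≤ t → Function.Periodic (fun k => e' k t) (N : ℤ))
    (hd : ∀ k t, 0 ≤ t → HasDerivWithinAt (e k) (e' k t) (Ici 0) t)
    (hd' : ∀ k t, 0 ≤ t → HasDerivWithinAt (e' k)
      (c ^ 2 * (e (k + 1) t - 2 * e k t + e (k - 1) t) - α * e' k t + τ k t) (Ici 0) t)
    (hτ : ∀ k ∈ Finset.range N, ∀ t ∈ Icc 0 T, |τ k t| ≤ η) {t : ℝ} (ht : t ∈ Icc 0 T) :
    chainEnergy c N (fun k => e k t) (fun k => e' k t) ≤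
      Real.exp (2 * T) * (chainEnergy c N (fun k => e k 0) (fun k => e' k 0) + η ^ 2) := by
  set E : ℝ → ℝ := fun t => chainEnergy c N (fun k => e k t) (fun k => e' k t) with hE
  have hN' : (0 : ℝ) < N := by exact_mod_cast hN
  set E' : ℝ → ℝ := fun t => (∑ k ∈ Finset.range N,
        (2 * (e k t * e' k t) - 2 * α * e' k t ^ 2 + 2 * (e' k t * τ k t))) / N with hE'
  have hEd : ∀ t, 0 ≤ t → HasDerivWithinAt E (E' t) (Ici 0) t := fun t ht =>
    HasDerivWithinAt.chainEnergy (he t ht) (he' t ht) (fun k => hd k t ht) (fun k => hd' k t ht)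
  have hbound : ∀ t ∈ Icc 0 T, E' t ≤ 2 * E t + η ^ 2 := fun t ht => by
    have hη : 2 * E t + η ^ 2 = (∑ k ∈ Finset.range N,
        (2 * (e k t ^ 2 + e' k t ^ 2 + c ^ 2 * (e (k + 1) t - e k t) ^ 2) + η ^ 2)) / N := by
      rw [Finset.sum_add_distrib, ← Finset.mul_sum, Finset.sum_const, Finset.card_range,
        nsmul_eq_mul, hE]
      simp only [chainEnergy]
      field_simp
    rw [hη]
    refine div_le_div_of_nonneg_right (Finset.sum_le_sum fun k hk => ?_) hN'.le
    have h1 := sq_le_sq' (abs_le.1 (hτ k hk t ht)).1 (abs_le.1 (hτ k hk t ht)).2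
    nlinarith [sq_nonneg (e k t - e' k t), sq_nonneg (e' k t - τ k t),
      mul_nonneg hα (sq_nonneg (e' k t)), sq_nonneg (c * (e (k + 1) t - e k t)),
      sq_nonneg (e k t)]
  have hanti : AntitoneOn (fun t => Real.exp (-2 * t) * (E t + η ^ 2 / 2)) (Icc 0 T) := by
    have hΦ : ∀ t, 0 ≤ t → HasDerivWithinAt (fun t => Real.exp (-2 * t) * (E t + η ^ 2 / 2))
        (Real.exp (-2 * t) * (E' t - 2 * E t - η ^ 2)) (Ici 0) t := fun t ht => by
      have h1 : HasDerivAt (fun t : ℝ => Real.exp (-2 * t)) (Real.exp (-2 * t) * (-2 * 1)) t :=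
        ((hasDerivAt_id t).const_mul (-2)).exp
      refine (h1.hasDerivWithinAt.fun_mul ((hEd t ht).add_const (η ^ 2 / 2))).congr_deriv ?_
      ring
    refine antitoneOn_of_hasDerivWithinAt_nonpos (convex_Icc 0 T)
      (f' := fun t => Real.exp (-2 * t) * (E' t - 2 * E t - η ^ 2))
      (fun t ht => ((hΦ t ht.1).continuousWithinAt.mono Icc_subset_Ici_self)) ?_ ?_
    · intro t ht
      exact (hΦ t (interior_subset ht).1).mono (interior_subset.trans Icc_subset_Ici_self)
    · intro t ht
      have := hbound t (interior_subset ht)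
      exact mul_nonpos_of_nonneg_of_nonpos (Real.exp_pos _).le (by linarith)
  have h0 := hanti (left_mem_Icc.2 (ht.1.trans ht.2)) ht ht.1
  simp only [mul_zero, Real.exp_zero, one_mul] at h0
  have hmul := mul_le_mul_of_nonneg_left h0 (Real.exp_pos (2 * t)).le
  rw [← mul_assoc, ← Real.exp_add, show 2 * t + -2 * t = 0 by ring, Real.exp_zero, one_mul] at hmul
  have hE0 : 0 ≤ E 0 := chainEnergy_nonneg _ _ _ _
  calc E t ≤ Real.exp (2 * t) * (E 0 + η ^ 2 / 2) := by nlinarith [sq_nonneg η]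
    _ ≤ Real.exp (2 * T) * (E 0 + η ^ 2) := by
      gcongr
      · exact ht.2
      · nlinarith [sq_nonneg η]

/-! ### Partial derivatives on the closed half plane. -/

section Partials

variable {F : ℝ × ℝ → ℝ}

theorem uniqueDiffOn_halfPlane : UniqueDiffOn ℝ (Ici (0 : ℝ) ×ˢ (univ : Set ℝ)) :=
  (uniqueDiffOn_Ici 0).prod uniqueDiffOn_univ

theorem hasDerivWithinAt_fst_of_contDiffOn (hF : ContDiffOn ℝ 1 F (Ici 0 ×ˢ univ)) (z : ℝ) {t : ℝ}
    (ht : 0 ≤ t) : HasDerivWithinAt (fun s => F (s, z))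
      (fderivWithin ℝ F (Ici 0 ×ˢ univ) (t, z) (1, 0)) (Ici 0) t := by
  have h1 : HasFDerivWithinAt F (fderivWithin ℝ F (Ici 0 ×ˢ univ) (t, z)) (Ici 0 ×ˢ univ) (t, z) :=
    (hF.differentiableOn one_ne_zero (t, z) ⟨ht, mem_univ z⟩).hasFDerivWithinAt
  have h2 : HasDerivWithinAt (fun s : ℝ => (s, z)) (1, 0) (Ici 0) t :=
    (hasDerivWithinAt_id t _).prodMk (hasDerivWithinAt_const t _ z)
  exact h1.comp_hasDerivWithinAt t h2 (fun s hs => mk_mem_prod hs (mem_univ z))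

theorem hasDerivAt_snd_of_contDiffOn (hF : ContDiffOn ℝ 1 F (Ici 0 ×ˢ univ)) (z : ℝ) {t : ℝ}
    (ht : 0 ≤ t) : HasDerivAt (fun w => F (t, w))
      (fderivWithin ℝ F (Ici 0 ×ˢ univ) (t, z) (0, 1)) z := by
  have h1 : HasFDerivWithinAt F (fderivWithin ℝ F (Ici 0 ×ˢ univ) (t, z)) (Ici 0 ×ˢ univ) (t, z) :=
    (hF.differentiableOn one_ne_zero (t, z) ⟨ht, mem_univ z⟩).hasFDerivWithinAt
  have h2 : HasDerivWithinAt (fun w : ℝ => (t, w)) (0, 1) univ z :=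
    (hasDerivWithinAt_const z _ t).prodMk (hasDerivWithinAt_id z _)
  rw [← hasDerivWithinAt_univ]
  exact h1.comp_hasDerivWithinAt z h2 (fun w _ => mk_mem_prod ht (mem_univ w))

theorem contDiffOn_fderivWithin_apply (hF : ContDiffOn ℝ 2 F (Ici 0 ×ˢ univ)) (w : ℝ × ℝ) :
    ContDiffOn ℝ 1 (fun p => fderivWithin ℝ F (Ici 0 ×ˢ univ) p w) (Ici 0 ×ˢ univ) :=
  (hF.fderivWithin uniqueDiffOn_halfPlane (by norm_num)).clm_apply contDiffOn_const

end Partials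

/-! ### Consistency and convergence of the chain. -/

section ChainError

variable {L ω₀ ω₁ α v : ℝ} {f X V : ℝ → ℝ} {G : ℝ → ℝ → ℝ}

theorem IsWaveSolution.exists_partials (h : IsWaveSolution L ω₁ α f X V v G) :
    ∃ Gt Gz Gzz : ℝ → ℝ → ℝ,
      (∀ z t, 0 ≤ t → HasDerivWithinAt (fun s => G s z) (Gt t z) (Ici 0) t) ∧
      (∀ z t, 0 ≤ t → HasDerivWithinAt (fun s => Gt s z)
        (ω₁ ^ 2 * Gzz t z - α * Gt t z + f t) (Ici 0) t) ∧
      (∀ t, 0 ≤ t → ∀ z, HasDerivAt (G t) (Gz t z) z) ∧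
      (∀ t, 0 ≤ t → ∀ z, HasDerivAt (Gz t) (Gzz t z) z) ∧
      ContinuousOn (fun p : ℝ × ℝ => Gzz p.1 p.2) (Ici 0 ×ˢ univ) := by
  set S : Set (ℝ × ℝ) := Ici 0 ×ˢ univ with hS
  set F : ℝ × ℝ → ℝ := fun p => G p.1 p.2 with hF
  have hF2 : ContDiffOn ℝ 2 F S := h.contDiffOn
  have hF1 : ContDiffOn ℝ 1 F S := hF2.of_le (by norm_num)
  set Ft : ℝ × ℝ → ℝ := fun p => fderivWithin ℝ F S p (1, 0) with hFt
  set Fz : ℝ × ℝ → ℝ := fun p => fderivWithin ℝ F S p (0, 1) with hFz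
  have hFt1 : ContDiffOn ℝ 1 Ft S := contDiffOn_fderivWithin_apply hF2 _
  have hFz1 : ContDiffOn ℝ 1 Fz S := contDiffOn_fderivWithin_apply hF2 _
  have ht1 : ∀ z t, 0 ≤ t → HasDerivWithinAt (fun s => G s z) (Ft (t, z)) (Ici 0) t :=
    fun z t ht => hasDerivWithinAt_fst_of_contDiffOn hF1 z ht
  have hz1 : ∀ t, 0 ≤ t → ∀ z, HasDerivAt (G t) (Fz (t, z)) z :=
    fun t ht z => hasDerivAt_snd_of_contDiffOn hF1 z ht
  have hz2 : ∀ t, 0 ≤ t → ∀ z,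
      HasDerivAt (fun w => Fz (t, w)) (fderivWithin ℝ Fz S (t, z) (0, 1)) z :=
    fun t ht z => hasDerivAt_snd_of_contDiffOn hFz1 z ht
  refine ⟨fun t z => Ft (t, z), fun t z => Fz (t, z),
    fun t z => fderivWithin ℝ Fz S (t, z) (0, 1), ht1, fun z t ht => ?_, hz1, hz2,
    (hFz1.continuousOn_fderivWithin uniqueDiffOn_halfPlane le_rfl).clm_apply continuousOn_const⟩
  have ht2 := hasDerivWithinAt_fst_of_contDiffOn hFt1 z ht
  refine ht2.congr_deriv ?_
  have hu := uniqueDiffOn_Ici (0 : ℝ)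
  have e1 : derivWithin (fun s => G s z) (Ici 0) t = Ft (t, z) :=
    (ht1 z t ht).derivWithin (hu t ht)
  have e2 : iteratedDerivWithin 2 (fun s => G s z) (Ici 0) t
      = fderivWithin ℝ Ft S (t, z) (1, 0) := by
    rw [iteratedDerivWithin_succ, iteratedDerivWithin_one,
      derivWithin_congr (fun s (hs : s ∈ Ici 0) => (ht1 z s hs).derivWithin (hu s hs))
        ((ht1 z t ht).derivWithin (hu t ht)), ht2.derivWithin (hu t ht)]
  have e3 : iteratedDeriv 2 (fun w => G t w) z = fderivWithin ℝ Fz S (t, z) (0, 1) := by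
    rw [iteratedDeriv_succ, iteratedDeriv_one]
    have : deriv (fun w => G t w) = fun w => Fz (t, w) := funext fun w => (hz1 t ht w).deriv
    rw [this, (hz2 t ht z).deriv]
  have := h.wave t ht z
  rw [e1, e2, e3] at this
  exact this

/-- As a function of `h`, the quantity inside the absolute value vanishes with its first derivative
at `0`, and its second derivative is at most `2ε`. The mean value inequality is applied twice. Only
a modulus of continuity of `g''` enters, so a `C²` solution suffices. -/
theorem abs_secondDiff_sub_le {g g' g'' : ℝ → ℝ} (hg : ∀ z, HasDerivAt g (g' z) z)
    (hg' : ∀ z, HasDerivAt g' (g'' z) z) {z h ε : ℝ} (hh : 0 ≤ h)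
    (hε : ∀ w, |w - z| ≤ h → |g'' w - g'' z| ≤ ε) :
    |g (z + h) - 2 * g z + g (z - h) - h ^ 2 * g'' z| ≤ 2 * ε * h ^ 2 := by
  have hε0 : 0 ≤ ε := (abs_nonneg _).trans (hε z (by simpa using hh))
  have hp : ∀ s : ℝ, HasDerivAt (fun s => z + s) 1 s := fun s => (hasDerivAt_id s).const_add z
  have hm : ∀ s : ℝ, HasDerivAt (fun s => z - s) (-1) s := fun s => (hasDerivAt_id s).const_sub z
  have h1 : ∀ s, HasDerivAt (fun s => g (z + s) - 2 * g z + g (z - s) - s ^ 2 * g'' z)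
      (g' (z + s) - g' (z - s) - 2 * s * g'' z) s := fun s => by
    refine ((((hg _).comp s (hp s)).sub_const (2 * g z)).fun_add ((hg _).comp s (hm s))).fun_sub
      (((hasDerivAt_id s).fun_pow 2).mul_const (g'' z)) |>.congr_deriv ?_
    simp
    ring
  have h2 : ∀ s, HasDerivAt (fun s => g' (z + s) - g' (z - s) - 2 * s * g'' z)
      (g'' (z + s) + g'' (z - s) - 2 * g'' z) s := fun s => by
    refine (((hg' _).comp s (hp s)).fun_sub ((hg' _).comp s (hm s))).fun_sub
      (((hasDerivAt_id s).const_mul 2).mul_const (g'' z)) |>.congr_deriv ?_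
    simp
  have b1 : ∀ s ∈ Icc 0 h, |g' (z + s) - g' (z - s) - 2 * s * g'' z| ≤ 2 * ε * h := fun s hs => by
    have := norm_image_sub_le_of_norm_deriv_le_segment' (a := 0) (b := h) (C := 2 * ε)
      (fun s _ => (h2 s).hasDerivWithinAt) (fun s hs => ?_) s hs
    · simp only [Real.norm_eq_abs, add_zero, sub_zero, sub_self, mul_zero, zero_mul] at this
      refine this.trans ?_
      gcongr
      exact hs.2
    · rw [Real.norm_eq_abs, show g'' (z + s) + g'' (z - s) - 2 * g'' z
        = (g'' (z + s) - g'' z) + (g'' (z - s) - g'' z) by ring]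
      refine (abs_add_le _ _).trans ?_
      have e1 := hε (z + s) (by rw [add_sub_cancel_left, abs_of_nonneg hs.1]; exact hs.2.le)
      have e2 := hε (z - s) (by
        rw [sub_sub_cancel_left, abs_neg, abs_of_nonneg hs.1]; exact hs.2.le)
      linarith
  have := norm_image_sub_le_of_norm_deriv_le_segment' (a := 0) (b := h) (C := 2 * ε * h)
      (fun s _ => (h1 s).hasDerivWithinAt) (fun s hs => b1 s (Ico_subset_Icc_self hs)) h
      (right_mem_Icc.2 hh)
  simp only [Real.norm_eq_abs, add_zero, sub_zero] at this
  calc _ = _ := by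
        congr 1
        have : g z - 2 * g z + g z - 0 ^ 2 * g'' z = 0 := by ring
        rw [this, sub_zero]
    _ ≤ _ := this
    _ = _ := by ring

theorem uniformContinuous_of_periodic {Y : ℝ → ℝ} (hL : 0 < L) (hY : Continuous Y)
    (hp : Function.Periodic Y L) : UniformContinuous Y := by
  have : Fact (0 < L) := ⟨hL⟩
  have hc : Continuous (hp.lift : AddCircle L → ℝ) := continuous_coinduced_dom.2 hY
  have hu := CompactSpace.uniformContinuous_of_continuous hc
  have hq : UniformContinuous ((↑) : ℝ → AddCircle L) :=
    uniformContinuous_of_continuousAt_zero (QuotientAddGroup.mk' (AddSubgroup.zmultiples L))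
      (AddCircle.continuous_mk' L).continuousAt
  exact hu.comp hq

/-- Each cell contributes the prescribed deviation `C/N²` and the quadrature error `η L/N`. Both are
`1/N` times something small, so the sum over a period stays small. -/
theorem abs_increment_sub_integral_le {Y : ℝ → ℝ} (hL : 0 < L) (hY : Continuous Y) {N : ℕ}
    (hN : 0 < N) {a : ℤ → ℝ} {C η : ℝ}
    (ha : ∀ k : ℤ, |a (k + 1) - a k - L / N * Y (k * L / N)| < C / (N : ℝ) ^ 2)
    (hη : ∀ u w, |u - w| ≤ L / N → |Y u - Y w| ≤ η) (k : ℤ) :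
    |(a (k + 1) - ∫ u in (0 : ℝ)..(((k + 1 : ℤ) : ℝ) * L / N), Y u)
      - (a k - ∫ u in (0 : ℝ)..(k * L / N), Y u)| ≤ (C / N + L * η) / N := by
  have hN' : (0 : ℝ) < N := by exact_mod_cast hN
  have hii : ∀ a b, IntervalIntegrable Y volume a b := fun a b => hY.intervalIntegrable a b
  have hle : (k : ℝ) * L / N + L / N = ((k + 1 : ℤ) : ℝ) * L / N := by push_cast; ring
  have hh : 0 < L / N := by positivity
  have h1 : (∫ u in (0 : ℝ)..(((k + 1 : ℤ) : ℝ) * L / N), Y u) - ∫ u in (0 : ℝ)..(k * L / N), Y u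
      = L / N * Y (k * L / N)
        + ∫ u in (k * L / N : ℝ)..(((k + 1 : ℤ) : ℝ) * L / N), (Y u - Y (k * L / N)) := by
    rw [intervalIntegral.integral_interval_sub_left (hii _ _) (hii _ _),
      intervalIntegral.integral_sub (hii _ _) (by simp), intervalIntegral.integral_const, ← hle]
    simp
  have h2 : |∫ u in (k * L / N : ℝ)..(((k + 1 : ℤ) : ℝ) * L / N), (Y u - Y (k * L / N))|
      ≤ η * (L / N) := by
    have := intervalIntegral.norm_integral_le_of_norm_le_const (a := (k * L / N : ℝ))
      (b := ((k + 1 : ℤ) : ℝ) * L / N) (f := fun u => Y u - Y (k * L / N)) (C := η) (fun u hu => ?_)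
    · rw [← hle, add_sub_cancel_left, abs_of_pos hh, hle] at this
      exact this
    · rw [← hle, uIoc_of_le (by linarith)] at hu
      exact hη _ _ (abs_le.2 ⟨by linarith [hu.1], by linarith [hu.2]⟩)
  have h3 : (a (k + 1) - ∫ u in (0 : ℝ)..(((k + 1 : ℤ) : ℝ) * L / N), Y u)
      - (a k - ∫ u in (0 : ℝ)..(k * L / N), Y u) = (a (k + 1) - a k - L / N * Y (k * L / N))
      - ∫ u in (k * L / N : ℝ)..(((k + 1 : ℤ) : ℝ) * L / N), (Y u - Y (k * L / N)) := by
    linarith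
  rw [h3]
  refine (abs_sub _ _).trans ((add_le_add (ha k).le h2).trans (le_of_eq ?_))
  field_simp

theorem IsMotion.periodic_velocity {ω : ℝ} {N : ℕ} {x xdot : ℤ → ℝ → ℝ}
    (h : IsMotion L ω α f N x xdot) (k : ℤ) {t : ℝ} (ht : 0 ≤ t) :
    xdot (k + N) t = xdot k t :=
  (uniqueDiffOn_Ici (0 : ℝ) t ht).eq_deriv _ (h.velocity (k + N) t ht)
    (((h.velocity k t ht).add_const L).congr (fun s hs => h.periodic k s hs) (h.periodic k t ht))

/-- The single parameter `η` dominates the data errors and the moduli of continuity of `X`, `V` and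
`G_zz` at scale `L/N`. The initial energy and the squared defect are then `O(η²)`, with constants
free of `N`. -/
theorem chain_error_le {T C₁ C₂ η : ℝ} (hL : 0 < L) (hω₀ : 0 < ω₀) (hα : 0 ≤ α)
    (hX : Continuous X) (hV : Continuous V) (hG : IsWaveSolution L (ω₀ * L) α f X V v G)
    {Gt Gz Gzz : ℝ → ℝ → ℝ}
    (hGt : ∀ z t, 0 ≤ t → HasDerivWithinAt (fun s => G s z) (Gt t z) (Ici 0) t)
    (hGtt : ∀ z t, 0 ≤ t → HasDerivWithinAt (fun s => Gt s z)
        ((ω₀ * L) ^ 2 * Gzz t z - α * Gt t z + f t) (Ici 0) t)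
    (hGz : ∀ t, 0 ≤ t → ∀ z, HasDerivAt (G t) (Gz t z) z)
    (hGzz : ∀ t, 0 ≤ t → ∀ z, HasDerivAt (Gz t) (Gzz t z) z)
    {N : ℕ} (hN : 0 < N) {x xdot : ℤ → ℝ → ℝ} (hm : IsMotion L (ω₀ * N) α f N x xdot)
    (hi : FollowsProfile L X V C₁ C₂ N (fun k => x k 0) (fun k => xdot k 0)) (hv : xdot 0 0 = v)
    (hC₁ : C₁ / N ≤ η) (hC₂ : C₂ / N ≤ η)
    (hηX : ∀ u w, |u - w| ≤ L / N → |X u - X w| ≤ η)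
    (hηV : ∀ u w, |u - w| ≤ L / N → |V u - V w| ≤ η)
    (hηG : ∀ t ∈ Icc 0 T, ∀ z ∈ Icc 0 L, ∀ w, |w - z| ≤ L / N → |Gzz t w - Gzz t z| ≤ η)
    (k : ℤ) {t : ℝ} (ht : t ∈ Icc 0 T) :
    |x k t - G t (k * L / N)| ≤ √(Real.exp (2 * T) *
      ((1 + L) ^ 2 * (2 + ω₀ ^ 2) + (2 * (ω₀ * L) ^ 2) ^ 2)) * η * (1 + 2 / ω₀) := by
  have hN' : (0 : ℝ) < N := by exact_mod_cast hN
  have hη : 0 ≤ η := by simpa using hηX 0 0 (by simp; positivity)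
  set e : ℤ → ℝ → ℝ := fun k t => x k t - G t (k * L / N) with he
  set e' : ℤ → ℝ → ℝ := fun k t => xdot k t - Gt t (k * L / N) with he'
  set τ : ℤ → ℝ → ℝ := fun k t => (ω₀ * N) ^ 2 * (G t (k * L / N + L / N) - 2 * G t (k * L / N)
    + G t (k * L / N - L / N) - (L / N) ^ 2 * Gzz t (k * L / N)) with hτ
  have hnode : ∀ k : ℤ, ((k + N : ℤ) : ℝ) * L / N = k * L / N + L := fun k => by
    push_cast; field_simp
  have hnode1 : ∀ k : ℤ, ((k + 1 : ℤ) : ℝ) * L / N = k * L / N + L / N := fun k => by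
    push_cast; field_simp
  have hnode2 : ∀ k : ℤ, ((k - 1 : ℤ) : ℝ) * L / N = k * L / N - L / N := fun k => by
    push_cast; field_simp
  have hGtper : ∀ t, 0 ≤ t → ∀ z, Gt t (z + L) = Gt t z := fun t ht z =>
    (uniqueDiffOn_Ici (0 : ℝ) t ht).eq_deriv _ (hGt (z + L) t ht)
      (((hGt z t ht).add_const L).congr (fun s hs => hG.quasiperiodic s hs z)
        (hG.quasiperiodic t ht z))
  have hper : ∀ t, 0 ≤ t → Function.Periodic (fun k => e k t) (N : ℤ) := fun t ht k => by
    simp only [he, hnode, hm.periodic k t ht, hG.quasiperiodic t ht]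
    ring
  have hper' : ∀ t, 0 ≤ t → Function.Periodic (fun k => e' k t) (N : ℤ) := fun t ht k => by
    simp only [he', hnode, hm.periodic_velocity k ht, hGtper t ht]
  have hd : ∀ k t, 0 ≤ t → HasDerivWithinAt (e k) (e' k t) (Ici 0) t := fun k t ht =>
    (hm.velocity k t ht).fun_sub (hGt _ t ht)
  have hd' : ∀ k t, 0 ≤ t → HasDerivWithinAt (e' k) ((ω₀ * N) ^ 2 *
      (e (k + 1) t - 2 * e k t + e (k - 1) t) - α * e' k t + τ k t) (Ici 0) t := fun k t ht => by
    refine ((hm.newton k t ht).fun_sub (hGtt _ t ht)).congr_deriv ?_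
    simp only [he, he', hτ, hnode1, hnode2]
    field_simp
    ring
  have hτη : ∀ k ∈ Finset.range N, ∀ t ∈ Icc 0 T, |τ k t| ≤ 2 * (ω₀ * L) ^ 2 * η :=
    fun k hk t ht => by
      have hk' : (k : ℝ) ≤ N := by exact_mod_cast (Finset.mem_range.1 hk).le
      have := abs_secondDiff_sub_le (hGz t ht.1) (hGzz t ht.1) (z := ((k : ℤ) : ℝ) * L / N)
        (h := L / N) (by positivity) (hηG t ht _ ⟨by push_cast; positivity, by
          rw [div_le_iff₀ hN', mul_comm L]; push_cast; gcongr⟩)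
      rw [hτ, abs_mul, abs_of_nonneg (by positivity : 0 ≤ (ω₀ * N) ^ 2)]
      refine (mul_le_mul_of_nonneg_left this (by positivity)).trans (le_of_eq ?_)
      field_simp
  have hG0 : ∀ z, G 0 z = ∫ u in (0 : ℝ)..z, X u := hG.initial_position
  have hGt0 : ∀ z, Gt 0 z = v + ∫ u in (0 : ℝ)..z, V u := fun z => by
    rw [← hG.initial_velocity, (hGt z 0 le_rfl).derivWithin (uniqueDiffOn_Ici _ _ self_mem_Ici)]
  -- The factor `1/N` is used twice: it allows summation over `N` sites, and it compensates the
  -- stiffness `(ω₀N)²` in the elastic energy.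
  have hinc : ∀ k, |e (k + 1) 0 - e k 0| ≤ (1 + L) * η / N := fun k => by
    have := abs_increment_sub_integral_le (a := fun k => x k 0) hL hX hN hi.position hηX k
    simp only [he, hG0]
    refine this.trans ?_
    gcongr
    linarith
  have hinc' : ∀ k, |e' (k + 1) 0 - e' k 0| ≤ (1 + L) * η / N := fun k => by
    have := abs_increment_sub_integral_le (a := fun k => xdot k 0) hL hV hN hi.velocity hηV k
    simp only [he', hGt0]
    rw [sub_add_eq_sub_sub_swap, sub_add_eq_sub_sub_swap, sub_sub_sub_cancel_right]
    refine this.trans ?_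
    gcongr
    linarith
  have hsum : ∀ a : ℤ → ℝ, a 0 = 0 → (∀ k, |a (k + 1) - a k| ≤ (1 + L) * η / N) →
      ∀ j ∈ Finset.range N, a j ^ 2 ≤ ((1 + L) * η) ^ 2 := fun a ha0 ha j hj => by
    have h1 := abs_sub_le_sum_abs (e := a) (Finset.mem_range.1 hj).le
    have h2 := Finset.sum_le_sum (s := Finset.range N) fun k _ => ha k
    rw [Finset.sum_const, Finset.card_range, nsmul_eq_mul, mul_div_cancel₀ _ hN'.ne'] at h2
    rw [ha0, sub_zero] at h1
    rw [← sq_abs (a j)]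
    gcongr
    exact h1.trans h2
  have hsq := hsum (fun k => e k 0) (by simp [he, hG0, hi.origin]) hinc
  have hsq' := hsum (fun k => e' k 0) (by simp [he', hGt0, hv]) hinc'
  have hE0 : chainEnergy (ω₀ * N) N (fun k => e k 0) (fun k => e' k 0)
      ≤ (1 + L) ^ 2 * (2 + ω₀ ^ 2) * η ^ 2 := by
    rw [chainEnergy, div_le_iff₀ hN']
    refine (Finset.sum_le_card_nsmul _ _ ((1 + L) ^ 2 * (2 + ω₀ ^ 2) * η ^ 2) fun j hj => ?_).trans
      (by rw [Finset.card_range, nsmul_eq_mul, mul_comm])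
    have h3 : (ω₀ * N) ^ 2 * (e (j + 1) 0 - e j 0) ^ 2 ≤ ω₀ ^ 2 * ((1 + L) * η) ^ 2 := by
      rw [mul_pow, mul_assoc, ← mul_pow, ← sq_abs ((N : ℝ) * _), abs_mul, Nat.abs_cast]
      have := hinc j
      rw [le_div_iff₀' hN'] at this
      exact mul_le_mul_of_nonneg_left (pow_le_pow_left₀ (by positivity) this 2) (sq_nonneg ω₀)
    linarith [hsq j hj, hsq' j hj]
  have hE := chainEnergy_le hα hN hper hper' hd hd' hτη ht
  have hE2 : chainEnergy (ω₀ * N) N (fun k => e k t) (fun k => e' k t) ≤ Real.exp (2 * T) *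
      ((1 + L) ^ 2 * (2 + ω₀ ^ 2) + (2 * (ω₀ * L) ^ 2) ^ 2) * η ^ 2 := by
    refine hE.trans ?_
    rw [mul_assoc (Real.exp _), add_mul, ← mul_pow]
    gcongr
  refine (abs_le_of_chainEnergy hω₀ hN (fun k => e' k t) (hper t ht.1) k).trans ?_
  gcongr
  refine (Real.sqrt_le_sqrt hE2).trans_eq ?_
  rw [Real.sqrt_mul (by positivity), Real.sqrt_sq hη]

theorem eventually_abs_chain_sub_lt {C₁ C₂ T ε : ℝ} (hL : 0 < L) (hω₀ : 0 < ω₀) (hα : 0 ≤ α)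
    (hX : Continuous X) (hV : Continuous V) (hXp : Function.Periodic X L)
    (hVp : Function.Periodic V L) (hG : IsWaveSolution L (ω₀ * L) α f X V v G)
    {x xdot : ℕ → ℤ → ℝ → ℝ}
    (hmotion : ∀ᶠ N : ℕ in atTop, IsMotion L (ω₀ * N) α f N (x N) (xdot N))
    (hinit : ∀ᶠ N : ℕ in atTop, FollowsProfile L X V C₁ C₂ N
      (fun k => x N k 0) (fun k => xdot N k 0))
    (hv : ∀ᶠ N : ℕ in atTop, xdot N 0 0 = v) (hε : 0 < ε) :
    ∀ᶠ N : ℕ in atTop, ∀ k : ℤ, ∀ t ∈ Icc 0 T, |x N k t - G t (k * L / N)| < ε := by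
  obtain ⟨Gt, Gz, Gzz, hGt, hGtt, hGz, hGzz, hc⟩ := hG.exists_partials
  set K := √(Real.exp (2 * T) *
      ((1 + L) ^ 2 * (2 + ω₀ ^ 2) + (2 * (ω₀ * L) ^ 2) ^ 2)) with hK
  have hK0 : 0 ≤ K := Real.sqrt_nonneg _
  -- The `K + 1` avoids dividing by a possibly zero `K` and makes the final bound `K / (K + 1) * ε`,
  -- strictly below `ε`.
  set η := ε / ((K + 1) * (1 + 2 / ω₀)) with hη
  have hη0 : 0 < η := by positivity
  have hlim : ∀ C : ℝ, Tendsto (fun N : ℕ => C / (N : ℝ)) atTop (𝓝 0) :=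
    tendsto_const_div_atTop_nhds_zero_nat
  -- Points within `L/N ≤ L` of a point of `[0, L]` stay in `[-L, 2L]`.
  have huc : UniformContinuousOn (fun p : ℝ × ℝ => Gzz p.1 p.2) (Icc 0 T ×ˢ Icc (-L) (2 * L)) :=
    (isCompact_Icc.prod isCompact_Icc).uniformContinuousOn_of_continuous
      (hc.mono (prod_mono Icc_subset_Ici_self (subset_univ _)))
  obtain ⟨d₁, hd₁, H₁⟩ := Metric.uniformContinuous_iff.1
    (uniformContinuous_of_periodic hL hX hXp) η hη0
  obtain ⟨d₂, hd₂, H₂⟩ := Metric.uniformContinuous_iff.1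
    (uniformContinuous_of_periodic hL hV hVp) η hη0
  obtain ⟨d₃, hd₃, H₃⟩ := Metric.uniformContinuousOn_iff.1 huc η hη0
  filter_upwards [hmotion, hinit, hv, eventually_gt_atTop 0, (hlim C₁).eventually_lt_const hη0,
    (hlim C₂).eventually_lt_const hη0, (hlim L).eventually_lt_const hd₁,
    (hlim L).eventually_lt_const hd₂, (hlim L).eventually_lt_const hd₃]
    with N hm hi hv hN h1 h2 h3 h4 h5 k t ht
  have hLN : L / N ≤ L := div_le_self hL.le (by exact_mod_cast hN)
  refine (chain_error_le hL hω₀ hα hX hV hG hGt hGtt hGz hGzz hN hm hi hv h1.le h2.le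
    (fun u w h => (H₁ (h.trans_lt h3)).le) (fun u w h => (H₂ (h.trans_lt h4)).le)
    (fun t ht z hz w h => ?_) k ht).trans_lt ?_
  · have hw := abs_le.1 h
    refine (H₃ (t, w) ⟨ht, ?_⟩ (t, z) ⟨ht, ?_⟩ ?_).le
    · constructor <;> linarith [hz.1, hz.2]
    · constructor <;> linarith [hz.1, hz.2]
    · rw [Prod.dist_eq, dist_self, max_eq_right dist_nonneg]
      exact h.trans_lt h5
  · rw [← hK, hη]
    have : 0 < 1 + 2 / ω₀ := by positivity
    have : K * (ε / ((K + 1) * (1 + 2 / ω₀))) * (1 + 2 / ω₀) = K / (K + 1) * ε := by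
      field_simp
    rw [this]
    exact mul_lt_of_lt_one_left hε ((div_lt_one (by positivity)).2 (lt_add_one K))

end ChainError

/-! ### Smoothness from continuous partial derivatives. -/

section BivariateSmoothness

variable {F Fx Fy : ℝ → ℝ → ℝ}

theorem hasFDerivAt_of_continuous_partials (hx : ∀ x y, HasDerivAt (fun s => F s y) (Fx x y) x)
    (hy : ∀ x y, HasDerivAt (F x) (Fy x y) y) (cx : Continuous fun p : ℝ × ℝ => Fx p.1 p.2)
    (cy : Continuous fun p : ℝ × ℝ => Fy p.1 p.2) (p : ℝ × ℝ) :
    HasFDerivAt (fun p : ℝ × ℝ => F p.1 p.2)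
      (Fx p.1 p.2 • ContinuousLinearMap.fst ℝ ℝ ℝ + Fy p.1 p.2 • ContinuousLinearMap.snd ℝ ℝ ℝ)
      p := by
  have h := (hasStrictFDerivAt_uncurry_coprod (u := p) (f := F)
    (f₁ := fun x y => ContinuousLinearMap.toSpanSingleton ℝ (Fx x y))
    (f₂ := fun x y => ContinuousLinearMap.toSpanSingleton ℝ (Fy x y))
    (Eventually.of_forall fun q => (hx q.1 q.2).hasFDerivAt)
    (Eventually.of_forall fun q => (hy q.1 q.2).hasFDerivAt)
    ((ContinuousLinearMap.toSpanSingletonCLE (𝕜 := ℝ) (E := ℝ)).continuous.comp cx).continuousAt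
    ((ContinuousLinearMap.toSpanSingletonCLE (𝕜 := ℝ) (E := ℝ)).continuous.comp
      cy).continuousAt).hasFDerivAt
  refine h.congr_fderiv ?_
  ext <;> simp [Function.HasUncurry.uncurry]

theorem contDiff_succ_of_partials {n : ℕ} (hx : ∀ x y, HasDerivAt (fun s => F s y) (Fx x y) x)
    (hy : ∀ x y, HasDerivAt (F x) (Fy x y) y) (cx : ContDiff ℝ n fun p : ℝ × ℝ => Fx p.1 p.2)
    (cy : ContDiff ℝ n fun p : ℝ × ℝ => Fy p.1 p.2) :
    ContDiff ℝ (n + 1) fun p : ℝ × ℝ => F p.1 p.2 :=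
  contDiff_succ_iff_hasFDerivAt.2 ⟨_, (cx.smul contDiff_const).add (cy.smul contDiff_const),
    hasFDerivAt_of_continuous_partials hx hy cx.continuous cy.continuous⟩

end BivariateSmoothness

/-! ### Termwise differentiation of series of products. -/

section ModeSum

/-- The real part of the series `∑ₙ pₙ(t) qₙ(z)`. -/
def modeSum (p q : ℤ → ℝ → ℂ) (t z : ℝ) : ℝ := ∑' n, (p n t * q n z).re

/-- The series `∑ₙ pₙ(t) qₙ(z)` converges normally on every strip `|t| ≤ T`. -/
def IsDominated (p q : ℤ → ℝ → ℂ) : Prop :=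
  ∀ T : ℝ, ∃ u : ℤ → ℝ, Summable u ∧ ∀ n t z, |t| ≤ T → ‖p n t * q n z‖ ≤ u n

variable {p p' q q' : ℤ → ℝ → ℂ}

theorem IsDominated.summable (h : IsDominated p q) (t z : ℝ) :
    Summable fun n => p n t * q n z := by
  obtain ⟨u, hu, hb⟩ := h |t|
  exact Summable.of_norm_bounded hu fun n => hb n t z le_rfl

theorem IsDominated.summable_re (h : IsDominated p q) (t z : ℝ) :
    Summable fun n => (p n t * q n z).re :=
  (Complex.hasSum_re (h.summable t z).hasSum).summable

theorem IsDominated.continuous (h : IsDominated p q) (hp : ∀ n, Continuous (p n))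
    (hq : ∀ n, Continuous (q n)) : Continuous fun x : ℝ × ℝ => modeSum p q x.1 x.2 := by
  rw [continuous_iff_continuousAt]
  intro x
  obtain ⟨u, hu, hb⟩ := h (|x.1| + 1)
  have hopen : IsOpen {y : ℝ × ℝ | |y.1| < |x.1| + 1} :=
    isOpen_lt (by fun_prop) continuous_const
  refine ContinuousOn.continuousAt (s := {y : ℝ × ℝ | |y.1| < |x.1| + 1}) ?_
    (hopen.mem_nhds (by simp))
  refine continuousOn_tsum (fun n => ?_) hu fun n y hy =>
    (Complex.abs_re_le_norm _).trans (hb n y.1 y.2 (le_of_lt hy))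
  exact (Complex.continuous_re.comp
    (((hp n).comp continuous_fst).mul ((hq n).comp continuous_snd))).continuousOn

theorem hasDerivAt_re {g : ℝ → ℂ} {g' : ℂ} {t : ℝ} (h : HasDerivAt g g' t) :
    HasDerivAt (fun s => (g s).re) g'.re t :=
  (Complex.reCLM.hasFDerivAt (x := g t)).comp_hasDerivAt t h

theorem IsDominated.hasDerivAt_fst (h : IsDominated p q) (h' : IsDominated p' q)
    (hp : ∀ n t, HasDerivAt (p n) (p' n t) t) (t z : ℝ) :
    HasDerivAt (fun s => modeSum p q s z) (modeSum p' q t z) t := by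
  obtain ⟨u, hu, hb⟩ := h' (|t| + 1)
  have hmem : t ∈ Ioo (-(|t| + 1)) (|t| + 1) := abs_lt.1 (lt_add_one |t|)
  exact hasDerivAt_tsum_of_isPreconnected hu isOpen_Ioo isPreconnected_Ioo
    (fun n s _ => hasDerivAt_re ((hp n s).mul_const (q n z)))
    (fun n s hs => (Complex.abs_re_le_norm _).trans (hb n s z (abs_lt.2 hs).le)) hmem
    (h.summable_re t z) hmem

theorem IsDominated.hasDerivAt_snd (h : IsDominated p q) (h' : IsDominated p q')
    (hq : ∀ n z, HasDerivAt (q n) (q' n z) z) (t z : ℝ) :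
    HasDerivAt (modeSum p q t) (modeSum p q' t z) z := by
  obtain ⟨u, hu, hb⟩ := h' |t|
  exact hasDerivAt_tsum hu (fun n s => hasDerivAt_re ((hq n s).const_mul (p n t)))
    (fun n s => (Complex.abs_re_le_norm _).trans (hb n t s le_rfl)) (h.summable_re t z) z

end ModeSum

/-! ### The oscillator `y'' = D y`, uniformly in `D`. -/

section Oscillator

/-- The solution of `y'' = D y` with `y 0 = 1`, `y' 0 = 0`. -/
def oscA (D t : ℝ) : ℝ := if 0 ≤ D then Real.cosh (√|D| * t) else Real.cos (√|D| * t)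

/-- The solution of `y'' = D y` with `y 0 = 0`, `y' 0 = 1`. -/
def oscB (D t : ℝ) : ℝ :=
  if 0 < D then Real.sinh (√|D| * t) / √|D| else if D < 0 then Real.sin (√|D| * t) / √|D| else t

theorem hasDerivAt_oscA (D t : ℝ) : HasDerivAt (oscA D) (D * oscB D t) t := by
  have hlin : HasDerivAt (fun s => √|D| * s) √|D| t := by
    simpa using (hasDerivAt_id t).const_mul √|D|
  have hsq : √|D| * √|D| = |D| := Real.mul_self_sqrt (abs_nonneg D)
  rcases lt_trichotomy D 0 with h | h | h
  · have h1 : oscA D = fun t => Real.cos (√|D| * t) := by ext; simp [oscA, h.not_ge]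
    have h2 : 0 < √|D| := Real.sqrt_pos.2 (abs_pos.2 h.ne)
    rw [h1]
    refine hlin.cos.congr_deriv ?_
    simp only [oscB, h.not_gt, h, if_true, if_false]
    field_simp
    rw [sq, hsq, abs_of_neg h]
    ring
  · have h1 : oscA D = fun t => 1 := by ext; simp [oscA, h]
    rw [h1, h, zero_mul]
    exact hasDerivAt_const t 1
  · have h1 : oscA D = fun t => Real.cosh (√|D| * t) := by ext; simp [oscA, h.le]
    have h2 : 0 < √|D| := Real.sqrt_pos.2 (abs_pos.2 h.ne')
    rw [h1]
    refine hlin.cosh.congr_deriv ?_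
    simp only [oscB, h, if_true]
    field_simp
    rw [sq, hsq, abs_of_pos h, mul_comm]

theorem hasDerivAt_oscB (D t : ℝ) : HasDerivAt (oscB D) (oscA D t) t := by
  have hlin : HasDerivAt (fun s => √|D| * s) √|D| t := by
    simpa using (hasDerivAt_id t).const_mul √|D|
  rcases lt_trichotomy D 0 with h | h | h
  · have h1 : oscB D = fun t => Real.sin (√|D| * t) / √|D| := by ext; simp [oscB, h.not_gt, h]
    have h2 : 0 < √|D| := Real.sqrt_pos.2 (abs_pos.2 h.ne)
    rw [h1]
    refine (hlin.sin.div_const _).congr_deriv ?_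
    simp only [oscA, h.not_ge, if_false]
    field_simp
  · have h1 : oscB D = fun t => t := by ext; simp [oscB, h]
    rw [h1]
    refine (hasDerivAt_id t).congr_deriv ?_
    simp [oscA, h]
  · have h1 : oscB D = fun t => Real.sinh (√|D| * t) / √|D| := by ext; simp [oscB, h]
    have h2 : 0 < √|D| := Real.sqrt_pos.2 (abs_pos.2 h.ne')
    rw [h1]
    refine (hlin.sinh.div_const _).congr_deriv ?_
    simp only [oscA, h.le, if_true]
    field_simp

@[simp] theorem oscA_zero (D : ℝ) : oscA D 0 = 1 := by simp [oscA]

@[simp] theorem oscB_zero (D : ℝ) : oscB D 0 = 0 := by simp [oscB]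

/-- Only an upper bound on `D` is required, so the estimate is uniform over all modes even though
their `D` tends to `-∞`. -/
theorem abs_oscA_le {D a T t : ℝ} (ha : 0 ≤ a) (hD : D ≤ a ^ 2) (ht : |t| ≤ T) :
    |oscA D t| ≤ Real.exp (a * T) := by
  have hT : 0 ≤ T := (abs_nonneg t).trans ht
  by_cases h : 0 ≤ D
  · simp only [oscA, h, if_true, abs_of_pos (Real.cosh_pos _)]
    rw [← Real.cosh_abs, abs_mul, abs_of_nonneg (Real.sqrt_nonneg _), abs_of_nonneg h]
    have h1 : √D * |t| ≤ a * T := by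
      gcongr
      exact (Real.sqrt_le_left ha).2 hD
    refine le_trans ?_ (Real.exp_le_exp.2 h1)
    rw [Real.cosh_eq]
    have : Real.exp (-(√D * |t|)) ≤ Real.exp (√D * |t|) :=
      Real.exp_le_exp.2 (by have : 0 ≤ √D * |t| := by positivity
                            linarith)
    linarith
  · simp only [oscA, h, if_false]
    exact (Real.abs_cos_le_one _).trans (Real.one_le_exp (by positivity))

theorem abs_oscB_le {D a T t : ℝ} (ha : 0 ≤ a) (hD : D ≤ a ^ 2) (ht : |t| ≤ T) :
    |oscB D t| ≤ Real.exp (a * T) * T := by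
  have hT : 0 ≤ T := (abs_nonneg t).trans ht
  have := (convex_Icc (-T) T).norm_image_sub_le_of_norm_hasDerivWithin_le
    (fun s _ => (hasDerivAt_oscB D s).hasDerivWithinAt)
    (fun s hs => abs_oscA_le ha hD (abs_le.2 hs)) (x := 0) (y := t) ⟨neg_nonpos.2 hT, hT⟩
    (abs_le.1 ht)
  simp only [oscB_zero, sub_zero, Real.norm_eq_abs] at this
  exact this.trans (by gcongr)

/-- The sine solution gains one factor of frequency. For `D ≥ 0` one has `μ ≤ a`. For `D < 0` one
has `μ ≤ a + √|D|` and `√|D| |oscB| ≤ 1`, so nothing degenerates as `D` approaches `0`. -/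
theorem mul_abs_oscB_le {a μ T t : ℝ} (ha : 0 ≤ a) (hμ : 0 ≤ μ) (ht : |t| ≤ T) :
    μ * |oscB (a ^ 2 - μ ^ 2) t| ≤ Real.exp (a * T) * (1 + a * T) := by
  have hT : 0 ≤ T := (abs_nonneg t).trans ht
  have hB := abs_oscB_le ha (by nlinarith : a ^ 2 - μ ^ 2 ≤ a ^ 2) ht
  have hB' : a * |oscB (a ^ 2 - μ ^ 2) t| ≤ a * (Real.exp (a * T) * T) :=
    mul_le_mul_of_nonneg_left hB ha
  have he : 1 ≤ Real.exp (a * T) := Real.one_le_exp (by positivity)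
  rcases le_or_gt 0 (a ^ 2 - μ ^ 2) with h | h
  · have hμa : μ ≤ a := by nlinarith
    have := mul_le_mul_of_nonneg_right hμa (abs_nonneg (oscB (a ^ 2 - μ ^ 2) t))
    linarith
  · set s := √|a ^ 2 - μ ^ 2| with hs
    have hs0 : 0 < s := Real.sqrt_pos.2 (abs_pos.2 h.ne)
    have hss : s ^ 2 = μ ^ 2 - a ^ 2 := by
      rw [hs, Real.sq_sqrt (abs_nonneg _), abs_of_neg h]; ring
    have hμ' : μ ≤ a + s := by nlinarith
    have h1 : s * |oscB (a ^ 2 - μ ^ 2) t| ≤ 1 := by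
      simp only [oscB, h.not_gt, h, if_true, if_false, ← hs]
      rw [abs_div, abs_of_pos hs0, mul_div_cancel₀ _ hs0.ne']
      exact Real.abs_sin_le_one _
    have := mul_le_mul_of_nonneg_right hμ' (abs_nonneg (oscB (a ^ 2 - μ ^ 2) t))
    linarith

end Oscillator

/-! ### Decay of Fourier coefficients and inversion. -/

section Fourier

variable {L : ℝ} {h : ℝ → ℝ}

theorem waveNumber_neg (L : ℝ) (n : ℤ) : waveNumber L (-n) = -waveNumber L n := by
  simp only [waveNumber]; push_cast; ring

@[simp] theorem waveNumber_zero (L : ℝ) : waveNumber L 0 = 0 := by simp [waveNumber]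

theorem waveNumber_ne_zero (hL : 0 < L) {n : ℤ} (hn : n ≠ 0) : waveNumber L n ≠ 0 := by
  have : (n : ℝ) ≠ 0 := by exact_mod_cast hn
  unfold waveNumber
  positivity

theorem exp_waveNumber_mul_period (hL : 0 < L) (n : ℤ) :
    Complex.exp (Complex.I * (waveNumber L n * L : ℝ)) = 1 := by
  have : Complex.I * (waveNumber L n * L : ℝ) = n * (2 * Real.pi * Complex.I) := by
    rw [waveNumber, div_mul_cancel₀ _ hL.ne']; push_cast; ring
  rw [this, Complex.exp_int_mul_two_pi_mul_I]

theorem norm_exp_I_mul (x : ℝ) : ‖Complex.exp (Complex.I * x)‖ = 1 := by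
  rw [mul_comm, Complex.norm_exp_ofReal_mul_I]

theorem continuous_exp_waveNumber (L : ℝ) (n : ℤ) :
    Continuous fun u : ℝ => Complex.exp (Complex.I * (waveNumber L n * u : ℝ)) := by
  fun_prop

theorem norm_fourierCoef_le (hL : 0 < L) (h : ℝ → ℝ) (n : ℤ) :
    ‖fourierCoef L h n‖ ≤ 1 / L * ∫ u in (0 : ℝ)..L, |h u| := by
  rw [fourierCoef, norm_mul]
  have : ‖(1 / L : ℂ)‖ = 1 / L := by
    rw [norm_div, norm_one, Complex.norm_real, Real.norm_of_nonneg hL.le]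
  rw [this]
  gcongr
  refine (intervalIntegral.norm_integral_le_integral_norm hL.le).trans (le_of_eq ?_)
  refine intervalIntegral.integral_congr fun u _ => ?_
  simp only [norm_mul, norm_exp_I_mul, one_mul, Complex.norm_real, Real.norm_eq_abs]

/-- Integration by parts over one period, where the boundary terms cancel. -/
theorem waveNumber_mul_fourierCoef (hL : 0 < L) (hh : ContDiff ℝ 1 h) (hp : Function.Periodic h L)
    (n : ℤ) : Complex.I * waveNumber L n * fourierCoef L h n = -fourierCoef L (deriv h) n := by
  have hd : ∀ u : ℝ, HasDerivAt
      (fun u : ℝ => Complex.exp (Complex.I * (waveNumber L n * u : ℝ)) * (h u : ℂ))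
      (Complex.I * waveNumber L n * (Complex.exp (Complex.I * (waveNumber L n * u : ℝ)) * (h u : ℂ))
        + Complex.exp (Complex.I * (waveNumber L n * u : ℝ)) * ((deriv h u : ℝ) : ℂ)) u :=
      fun u => by
    have h1 : HasDerivAt (fun u : ℝ => Complex.I * ((waveNumber L n * u : ℝ) : ℂ))
        (Complex.I * waveNumber L n) u := by
      have := (((hasDerivAt_id u).const_mul (waveNumber L n)).ofReal_comp).const_mul Complex.I
      simpa using this
    have h2 := ((hh.differentiable one_ne_zero) u).hasDerivAt.ofReal_comp
    refine (h1.cexp.mul h2).congr_deriv ?_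
    ring
  have hc := hh.continuous
  have hc' := hh.continuous_deriv le_rfl
  have hE := continuous_exp_waveNumber L n
  have i1 : Continuous fun u : ℝ =>
      Complex.exp (Complex.I * (waveNumber L n * u : ℝ)) * (h u : ℂ) := by fun_prop
  have i2 : Continuous fun u : ℝ =>
      Complex.exp (Complex.I * (waveNumber L n * u : ℝ)) * ((deriv h u : ℝ) : ℂ) := by fun_prop
  have := intervalIntegral.integral_eq_sub_of_hasDerivAt (fun u _ => hd u)
    (((i1.const_mul _).add i2).intervalIntegrable 0 L)
  rw [intervalIntegral.integral_add ((i1.const_mul _).intervalIntegrable _ _)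
    (i2.intervalIntegrable _ _), intervalIntegral.integral_const_mul,
    exp_waveNumber_mul_period hL] at this
  have hL0 : h L = h 0 := by simpa using hp 0
  simp only [hL0, mul_zero, Complex.ofReal_zero, Complex.exp_zero, sub_self] at this
  unfold fourierCoef
  linear_combination (1 / L : ℂ) * this

theorem periodic_deriv (hp : Function.Periodic h L) : Function.Periodic (deriv h) L := fun u => by
  have : (fun w => h (w + L)) = h := funext hp
  rw [← deriv_comp_add_const, this]

theorem abs_waveNumber_pow_mul_norm_fourierCoef (hL : 0 < L) (m : ℕ) (n : ℤ) :
    ∀ {h : ℝ → ℝ}, ContDiff ℝ m h → Function.Periodic h L →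
      |waveNumber L n| ^ m * ‖fourierCoef L h n‖ = ‖fourierCoef L (iteratedDeriv m h) n‖ := by
  induction m with
  | zero => intro h _ _; simp
  | succ m ih =>
    intro h hh hp
    have h1 := congrArg norm (waveNumber_mul_fourierCoef hL (hh.of_le (by simp)) hp n)
    simp only [norm_mul, Complex.norm_I, one_mul, Complex.norm_real, Real.norm_eq_abs,
      norm_neg] at h1
    rw [iteratedDeriv_succ', ← ih (h := deriv h) ?_ (periodic_deriv hp), ← h1]
    · ring
    · exact (contDiff_succ_iff_deriv.1 (by exact_mod_cast hh)).2.2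

theorem exists_fourierCoef_bound (hL : 0 < L) {m : ℕ} (hh : ContDiff ℝ m h)
    (hp : Function.Periodic h L) :
    ∃ K, ∀ n, |waveNumber L n| ^ m * ‖fourierCoef L h n‖ ≤ K :=
  ⟨_, fun n => (abs_waveNumber_pow_mul_norm_fourierCoef hL m n hh hp).trans_le
    (norm_fourierCoef_le hL _ n)⟩

/-- Four derivatives are spent here: two pay for the weight and two for comparison with `∑ 1/n²`. -/
theorem summable_weight_mul_norm_fourierCoef (hL : 0 < L) (hh : ContDiff ℝ 4 h)
    (hp : Function.Periodic h L) :
    Summable fun n => (1 + |waveNumber L n|) ^ 2 * ‖fourierCoef L h n‖ := by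
  obtain ⟨K₂, hK₂⟩ := exists_fourierCoef_bound hL (m := 2) (hh.of_le (by norm_num)) hp
  obtain ⟨K₄, hK₄⟩ := exists_fourierCoef_bound hL (m := 4) hh hp
  have hs : Summable fun n : ℤ => L ^ 2 / (4 * Real.pi ^ 2) * (2 * (K₂ + K₄)) * (1 / (n : ℝ) ^ 2) :=
    (Real.summable_one_div_int_pow.2 one_lt_two).mul_left _
  refine Summable.of_norm_bounded_eventually hs ?_
  filter_upwards [eventually_cofinite_ne (0 : ℤ)] with n hn
  have hn' : (n : ℝ) ≠ 0 := by exact_mod_cast hn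
  have hw : (n : ℝ) ^ 2 = L ^ 2 / (4 * Real.pi ^ 2) * |waveNumber L n| ^ 2 := by
    rw [sq_abs, waveNumber]
    field_simp
    ring
  rw [Real.norm_of_nonneg (by positivity), mul_one_div, le_div_iff₀ (by positivity), hw]
  have h1 := hK₂ n
  have h2 := hK₄ n
  set l := |waveNumber L n| with hl
  set y := ‖fourierCoef L h n‖ with hy
  have hy0 : 0 ≤ y := norm_nonneg _
  have h3 : (1 + l) ^ 2 * y * l ^ 2 ≤ 2 * (K₂ + K₄) := by
    have : (1 + l) ^ 2 * y * l ^ 2 ≤ 2 * (l ^ 2 * y + l ^ 4 * y) := by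
      nlinarith [mul_nonneg (mul_nonneg hy0 (sq_nonneg l)) (sq_nonneg (1 - l))]
    linarith
  calc _ = L ^ 2 / (4 * Real.pi ^ 2) * ((1 + l) ^ 2 * y * l ^ 2) := by ring
    _ ≤ _ := by gcongr

theorem fourierCoef_neg (L : ℝ) (h : ℝ → ℝ) (n : ℤ) :
    fourierCoef L h (-n) = (starRingEnd ℂ) (fourierCoef L h n) := by
  rw [fourierCoef, fourierCoef, map_mul, ← intervalIntegral.intervalIntegral_conj]
  congr 1
  · simp
  · refine intervalIntegral.integral_congr fun u _ => ?_
    simp only [map_mul, ← Complex.exp_conj, Complex.conj_I, Complex.conj_ofReal, waveNumber_neg]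
    push_cast
    ring_nf

theorem fourierCoef_zero (L : ℝ) (h : ℝ → ℝ) :
    fourierCoef L h 0 = ((1 / L * ∫ u in (0 : ℝ)..L, h u : ℝ) : ℂ) := by
  simp [fourierCoef, intervalIntegral.integral_ofReal]

theorem hasSum_fourierCoef (hL : 0 < L) (hh : ContDiff ℝ 4 h) (hp : Function.Periodic h L)
    (z : ℝ) : HasSum (fun n => Complex.exp (-Complex.I * (waveNumber L n * z : ℝ)) *
      fourierCoef L h n) (h z) := by
  have : Fact (0 < L) := ⟨hL⟩
  have hp' : Function.Periodic (fun u => (h u : ℂ)) L := fun u => by simp only [hp u]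
  let F : C(AddCircle L, ℂ) := ⟨hp'.lift,
    continuous_coinduced_dom.2 (Complex.continuous_ofReal.comp hh.continuous)⟩
  have hF : ∀ u : ℝ, F (u : AddCircle L) = h u := fun u => rfl
  -- `fourierCoef` carries `exp(+iλₙu)`, the opposite sign to `fourierCoeff`; hence the reflection
  -- `n ↦ -n`.
  have hcoef : ∀ n, fourierCoeff F n = fourierCoef L h (-n) := fun n => by
    rw [fourierCoeff_eq_intervalIntegral F n 0, zero_add, fourierCoef, Complex.real_smul]
    congr 1
    · push_cast; rfl
    · refine intervalIntegral.integral_congr fun u _ => ?_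
      simp only [fourier_coe_apply, smul_eq_mul, hF]
      congr 2
      simp only [waveNumber]
      push_cast
      ring
  have hsum : Summable (fourierCoeff F) := by
    refine Summable.of_norm_bounded
      (g := fun n => (1 + |waveNumber L (-n)|) ^ 2 * ‖fourierCoef L h (-n)‖)
      ((Equiv.neg ℤ).summable_iff.2 (summable_weight_mul_norm_fourierCoef hL hh hp)) fun n => ?_
    rw [hcoef]
    exact le_mul_of_one_le_left (norm_nonneg _)
      (one_le_pow₀ (le_add_of_nonneg_right (abs_nonneg _)))
  have := has_pointwise_sum_fourier_series_of_summable hsum (z : AddCircle L)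
  rw [hF, ← (Equiv.neg ℤ).hasSum_iff] at this
  convert this using 2 with n
  simp only [Function.comp_apply, Equiv.neg_apply, hcoef, neg_neg, smul_eq_mul, fourier_coe_apply]
  rw [mul_comm]
  congr 2
  simp only [waveNumber]
  push_cast
  ring

end Fourier

/-! ### Time and space factors of the Fourier modes. -/

section Modes

variable {L ω α : ℝ} {X V : ℝ → ℝ}

theorem modeA_eq (L ω α : ℝ) (n : ℤ) (t : ℝ) :
    modeA L ω α n t = Real.exp (-α * t / 2) * oscA (disc L ω α n) t := rfl

theorem modeB_eq (L ω α : ℝ) (n : ℤ) (t : ℝ) :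
    modeB L ω α n t = Real.exp (-α * t / 2) * oscB (disc L ω α n) t := rfl

@[simp] theorem modeA_zero (L ω α : ℝ) (n : ℤ) : modeA L ω α n 0 = 1 := by simp [modeA_eq]

@[simp] theorem modeB_zero (L ω α : ℝ) (n : ℤ) : modeB L ω α n 0 = 0 := by simp [modeB_eq]

theorem disc_neg (L ω α : ℝ) (n : ℤ) : disc L ω α (-n) = disc L ω α n := by
  simp [disc, waveNumber_neg]

theorem modeA_neg (L ω α : ℝ) (n : ℤ) : modeA L ω α (-n) = modeA L ω α n := by
  ext t; simp only [modeA_eq, disc_neg]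

theorem modeB_neg (L ω α : ℝ) (n : ℤ) : modeB L ω α (-n) = modeB L ω α n := by
  ext t; simp only [modeB_eq, disc_neg]

theorem hasDerivAt_exp_damping (α t : ℝ) : HasDerivAt (fun t => Real.exp (-α * t / 2))
    (-(α / 2) * Real.exp (-α * t / 2)) t := by
  have := (((hasDerivAt_id t).const_mul (-α)).div_const 2).exp
  refine this.congr_deriv ?_
  simp only [id]
  ring

theorem hasDerivAt_modeA (L ω α : ℝ) (n : ℤ) (t : ℝ) : HasDerivAt (modeA L ω α n)
    (-(α / 2) * modeA L ω α n t + disc L ω α n * modeB L ω α n t) t := by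
  refine ((hasDerivAt_exp_damping α t).mul (hasDerivAt_oscA (disc L ω α n) t)).congr_deriv ?_
  rw [modeA_eq, modeB_eq]
  ring

theorem hasDerivAt_modeB (L ω α : ℝ) (n : ℤ) (t : ℝ) : HasDerivAt (modeB L ω α n)
    (-(α / 2) * modeB L ω α n t + modeA L ω α n t) t := by
  refine ((hasDerivAt_exp_damping α t).mul (hasDerivAt_oscB (disc L ω α n) t)).congr_deriv ?_
  rw [modeA_eq, modeB_eq]
  ring

theorem exists_mode_bound (L : ℝ) (hα : 0 ≤ α) (hω : 0 ≤ ω) (T : ℝ) : ∃ M, 0 ≤ M ∧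
    ∀ n t, |t| ≤ T → |modeA L ω α n t| ≤ M ∧ |modeB L ω α n t| ≤ M ∧
      |waveNumber L n| * ω * |modeB L ω α n t| ≤ M := by
  rcases lt_or_ge T 0 with hT | hT
  · exact ⟨0, le_rfl, fun n t ht => absurd ((abs_nonneg t).trans ht) hT.not_ge⟩
  set E := Real.exp (α / 2 * T) with hE
  have hE0 : 0 < E := Real.exp_pos _
  have ha : 0 ≤ α / 2 := by positivity
  -- One `E` bounds `exp(-αt/2)`, which grows at negative times; the other bounds the hyperbolic
  -- growth of overdamped modes.
  refine ⟨E * (E * (1 + T + α / 2 * T)), by positivity, fun n t ht => ?_⟩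
  have hD : disc L ω α n = (α / 2) ^ 2 - (|waveNumber L n| * ω) ^ 2 := by
    rw [disc, mul_pow, sq_abs]; ring
  have hle : disc L ω α n ≤ (α / 2) ^ 2 := by
    rw [hD]; linarith [sq_nonneg (|waveNumber L n| * ω)]
  have he : Real.exp (-α * t / 2) ≤ E := by
    apply Real.exp_le_exp.2
    nlinarith [(abs_le.1 ht).1]
  have hT2 : 0 ≤ α / 2 * T := by positivity
  have h1 := abs_oscA_le ha hle ht
  have h2 := abs_oscB_le ha hle ht
  have h3 := mul_abs_oscB_le ha (mul_nonneg (abs_nonneg (waveNumber L n)) hω) ht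
  rw [← hD] at h3
  rw [← hE] at h1 h2 h3
  refine ⟨?_, ?_, ?_⟩
  · rw [modeA_eq, abs_mul, Real.abs_exp]
    refine mul_le_mul he (h1.trans ?_) (abs_nonneg _) hE0.le
    nlinarith
  · rw [modeB_eq, abs_mul, Real.abs_exp]
    refine mul_le_mul he (h2.trans ?_) (abs_nonneg _) hE0.le
    nlinarith
  · rw [modeB_eq, abs_mul, Real.abs_exp, mul_left_comm]
    refine mul_le_mul he (h3.trans ?_) (by positivity) hE0.le
    nlinarith

/-- The time-dependent Fourier coefficient of the deviation. -/
def timeCoef (L ω α : ℝ) (X V : ℝ → ℝ) (n : ℤ) (t : ℝ) : ℂ :=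
  fourierCoef L X n * (modeA L ω α n t + α * modeB L ω α n t / 2 : ℝ)
    + fourierCoef L V n * (modeB L ω α n t : ℝ)

/-- The first time derivative of `timeCoef`. -/
def timeCoef' (L ω α : ℝ) (X V : ℝ → ℝ) (n : ℤ) (t : ℝ) : ℂ :=
  fourierCoef L X n * (-(waveNumber L n * ω) ^ 2 * modeB L ω α n t : ℝ)
    + fourierCoef L V n * (modeA L ω α n t - α / 2 * modeB L ω α n t : ℝ)

/-- The second time derivative of `timeCoef`. -/
def timeCoef'' (L ω α : ℝ) (X V : ℝ → ℝ) (n : ℤ) (t : ℝ) : ℂ :=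
  -α * timeCoef' L ω α X V n t - ((waveNumber L n * ω) ^ 2 : ℝ) * timeCoef L ω α X V n t

/-- In the derivative of `a + αb/2` the `a` terms cancel and `D - α²/4 = -(λω)²` remains. Thus `a +
αb/2` is the damped mode with unit position and zero velocity at time `0`. -/
theorem hasDerivAt_timeCoef (L ω α : ℝ) (X V : ℝ → ℝ) (n : ℤ) (t : ℝ) :
    HasDerivAt (timeCoef L ω α X V n) (timeCoef' L ω α X V n t) t := by
  have hA := hasDerivAt_modeA L ω α n t
  have hB := hasDerivAt_modeB L ω α n t
  have h1 := (hA.fun_add ((hB.const_mul α).div_const 2)).ofReal_comp.const_mul (fourierCoef L X n)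
  have h2 := hB.ofReal_comp.const_mul (fourierCoef L V n)
  refine (h1.fun_add h2).congr_deriv ?_
  simp only [timeCoef', disc]
  push_cast
  ring

theorem hasDerivAt_timeCoef' (L ω α : ℝ) (X V : ℝ → ℝ) (n : ℤ) (t : ℝ) :
    HasDerivAt (timeCoef' L ω α X V n) (timeCoef'' L ω α X V n t) t := by
  have hA := hasDerivAt_modeA L ω α n t
  have hB := hasDerivAt_modeB L ω α n t
  have h1 := (hB.const_mul (-(waveNumber L n * ω) ^ 2)).ofReal_comp.const_mul (fourierCoef L X n)
  have h2 := (hA.fun_sub (hB.const_mul (α / 2))).ofReal_comp.const_mul (fourierCoef L V n)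
  refine (h1.fun_add h2).congr_deriv ?_
  simp only [timeCoef'', timeCoef', timeCoef, disc]
  push_cast
  ring

/-- `∫₀ᶻ exp(-i λₙ y) dy` for `n ≠ 0`. -/
def spacePrim (L : ℝ) (n : ℤ) (z : ℝ) : ℂ :=
  (Complex.exp (-Complex.I * (waveNumber L n * z : ℝ)) - 1) / (-Complex.I * waveNumber L n)

/-- `exp(-i λₙ z)` for `n ≠ 0`, and `0` for `n = 0`. -/
def spaceMode (L : ℝ) (n : ℤ) (z : ℝ) : ℂ :=
  if n = 0 then 0 else Complex.exp (-Complex.I * (waveNumber L n * z : ℝ))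

/-- The derivative of `spaceMode`. -/
def spaceMode' (L : ℝ) (n : ℤ) (z : ℝ) : ℂ :=
  -Complex.I * waveNumber L n * Complex.exp (-Complex.I * (waveNumber L n * z : ℝ))

theorem hasDerivAt_exp_neg_waveNumber (L : ℝ) (n : ℤ) (z : ℝ) :
    HasDerivAt (fun z : ℝ => Complex.exp (-Complex.I * (waveNumber L n * z : ℝ)))
      (spaceMode' L n z) z := by
  have h1 : HasDerivAt (fun u : ℝ => -Complex.I * ((waveNumber L n * u : ℝ) : ℂ))
      (-Complex.I * waveNumber L n) z := by
    have := (((hasDerivAt_id z).const_mul (waveNumber L n)).ofReal_comp).const_mul (-Complex.I)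
    simpa using this
  refine h1.cexp.congr_deriv ?_
  rw [spaceMode', mul_comm]

theorem hasDerivAt_spacePrim (hL : 0 < L) (n : ℤ) (z : ℝ) :
    HasDerivAt (spacePrim L n) (spaceMode L n z) z := by
  refine (((hasDerivAt_exp_neg_waveNumber L n z).sub_const 1).div_const _).congr_deriv ?_
  -- At `n = 0` the numerator of `spacePrim` already vanishes and division by zero returns `0`, in
  -- agreement with `spaceMode`.
  by_cases hn : n = 0
  · simp [hn, spaceMode]
  · have : (waveNumber L n : ℂ) ≠ 0 := by exact_mod_cast waveNumber_ne_zero hL hn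
    rw [spaceMode', spaceMode, if_neg hn, mul_div_cancel_left₀]
    exact mul_ne_zero (neg_ne_zero.2 Complex.I_ne_zero) this

theorem hasDerivAt_spaceMode (L : ℝ) (n : ℤ) (z : ℝ) :
    HasDerivAt (spaceMode L n) (spaceMode' L n z) z := by
  by_cases hn : n = 0
  · have : spaceMode L n = fun _ => 0 := by ext; simp [spaceMode, hn]
    rw [this]
    exact (hasDerivAt_const z 0).congr_deriv (by simp [spaceMode', hn])
  · have : spaceMode L n = fun z => Complex.exp (-Complex.I * (waveNumber L n * z : ℝ)) := by
      ext; simp [spaceMode, hn]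
    rw [this]
    exact hasDerivAt_exp_neg_waveNumber L n z

@[simp] theorem spacePrim_apply_zero (L : ℝ) (n : ℤ) : spacePrim L n 0 = 0 := by simp [spacePrim]

/-- The mode-level source of the correction `r_x(t,0)`: a primitive normalised at `0` is an
eigenfunction of the second derivative only up to a constant. -/
theorem spaceMode'_sub (L : ℝ) (n : ℤ) (z : ℝ) :
    spaceMode' L n z - spaceMode' L n 0 = -(waveNumber L n : ℂ) ^ 2 * spacePrim L n z := by
  by_cases hn : (waveNumber L n : ℂ) = 0
  · simp [spaceMode', hn]
  · simp only [spaceMode', spacePrim, mul_zero, Complex.ofReal_zero, Complex.exp_zero]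
    have hI := Complex.I_ne_zero
    field_simp
    linear_combination (1 - Complex.exp (-(Complex.I * (waveNumber L n * z : ℝ)))) * Complex.I_sq

theorem norm_exp_neg_I_mul (x : ℝ) : ‖Complex.exp (-Complex.I * x)‖ = 1 := by
  have := norm_exp_I_mul (-x)
  rwa [Complex.ofReal_neg, mul_neg, ← neg_mul] at this

theorem exp_neg_waveNumber_add_period (hL : 0 < L) (n : ℤ) (z : ℝ) :
    Complex.exp (-Complex.I * (waveNumber L n * (z + L) : ℝ))
      = Complex.exp (-Complex.I * (waveNumber L n * z : ℝ)) := by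
  have : -Complex.I * (waveNumber L n * (z + L) : ℝ)
      = -Complex.I * (waveNumber L n * z : ℝ) - Complex.I * (waveNumber L n * L : ℝ) := by
    push_cast; ring
  rw [this, Complex.exp_sub, exp_waveNumber_mul_period hL, div_one]

theorem two_le_mul_abs_waveNumber (hL : 0 < L) {n : ℤ} (hn : n ≠ 0) :
    2 ≤ L * |waveNumber L n| := by
  have h1 : (1 : ℝ) ≤ |(n : ℝ)| := by exact_mod_cast Int.one_le_abs hn
  have h2 : L * |waveNumber L n| = 2 * Real.pi * |(n : ℝ)| := by
    rw [waveNumber, abs_div, abs_mul, abs_mul, abs_of_pos hL, abs_of_pos Real.pi_pos, abs_two]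
    field_simp
  rw [h2]
  nlinarith [Real.pi_gt_three]

theorem norm_spacePrim_le (hL : 0 < L) (n : ℤ) (z : ℝ) : ‖spacePrim L n z‖ ≤ L := by
  by_cases hn : n = 0
  · simp [spacePrim, hn, hL.le]
  · have h1 := two_le_mul_abs_waveNumber hL hn
    have h2 : 0 < |waveNumber L n| := abs_pos.2 (waveNumber_ne_zero hL hn)
    rw [spacePrim, norm_div, norm_mul, norm_neg, Complex.norm_I, one_mul, Complex.norm_real,
      Real.norm_eq_abs, div_le_iff₀ h2]
    refine (norm_sub_le _ _).trans ?_
    rw [norm_exp_neg_I_mul, norm_one]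
    linarith

theorem norm_spaceMode_le (L : ℝ) (n : ℤ) (z : ℝ) : ‖spaceMode L n z‖ ≤ 1 := by
  unfold spaceMode
  split_ifs
  · simp
  · rw [norm_exp_neg_I_mul]

theorem norm_spaceMode' (L : ℝ) (n : ℤ) (z : ℝ) : ‖spaceMode' L n z‖ = |waveNumber L n| := by
  rw [spaceMode', norm_mul, norm_exp_neg_I_mul, norm_mul, norm_neg, Complex.norm_I,
    Complex.norm_real, Real.norm_eq_abs, one_mul, mul_one]

/-- Each time derivative costs one power of `1 + |λₙ|`, as each space derivative does, so the weight
in the summability of the coefficients covers all derivatives of order two. -/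
theorem exists_timeCoef_bound (L : ℝ) (X V : ℝ → ℝ) (hα : 0 ≤ α) (hω : 0 ≤ ω) (T : ℝ) :
    ∃ K, 0 ≤ K ∧ ∀ n t, |t| ≤ T →
      ‖timeCoef L ω α X V n t‖ ≤ K * (‖fourierCoef L X n‖ + ‖fourierCoef L V n‖) ∧
      ‖timeCoef' L ω α X V n t‖
        ≤ K * (‖fourierCoef L X n‖ + ‖fourierCoef L V n‖) * (1 + |waveNumber L n|) ∧
      ‖timeCoef'' L ω α X V n t‖
        ≤ K * (‖fourierCoef L X n‖ + ‖fourierCoef L V n‖) * (1 + |waveNumber L n|) ^ 2 := by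
  obtain ⟨M, hM, hb⟩ := exists_mode_bound L hα hω T
  refine ⟨M * (1 + α) ^ 2 * (1 + ω) ^ 2, by positivity, fun n t ht => ?_⟩
  obtain ⟨hA, hB, hlB⟩ := hb n t ht
  set A := modeA L ω α n t with hAdef
  set B := modeB L ω α n t with hBdef
  set l := |waveNumber L n| with hl
  have hl0 : 0 ≤ l := abs_nonneg _
  set x := ‖fourierCoef L X n‖ with hx
  set y := ‖fourierCoef L V n‖ with hy
  have hx0 : 0 ≤ x := norm_nonneg _
  have hy0 : 0 ≤ y := norm_nonneg _
  have hMα : 0 ≤ M * α := by positivity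
  have b1 : |A + α * B / 2| ≤ M * (1 + α) := by
    refine (abs_add_le _ _).trans ?_
    rw [abs_div, abs_mul, abs_of_nonneg hα, abs_two]
    nlinarith [mul_le_mul_of_nonneg_left hB hα]
  have b2 : |A - α / 2 * B| ≤ M * (1 + α) := by
    refine (abs_sub _ _).trans ?_
    rw [abs_mul, abs_of_nonneg (by positivity : 0 ≤ α / 2)]
    nlinarith [mul_le_mul_of_nonneg_left hB hα]
  have b3 : |-(waveNumber L n * ω) ^ 2 * B| ≤ M * (1 + ω) * (1 + l) := by
    rw [abs_mul, abs_neg, abs_pow, abs_mul, abs_of_nonneg hω, ← hl]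
    -- One of the two factors `lω` is absorbed by `B`, by the frequency gain in the mode bound.
    have h1 : (l * ω) ^ 2 * |B| = l * ω * (l * ω * |B|) := by ring
    rw [h1]
    have h2 : l * ω * (l * ω * |B|) ≤ l * ω * M := by gcongr
    have h3 : l * ω * M ≤ (1 + l) * (1 + ω) * M := by gcongr <;> linarith
    linarith
  have c0 : ‖timeCoef L ω α X V n t‖ ≤ M * (1 + α) * (x + y) := by
    refine (norm_add_le _ _).trans ?_
    rw [norm_mul, norm_mul, Complex.norm_real, Complex.norm_real, Real.norm_eq_abs,
      Real.norm_eq_abs]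
    have h1 := mul_le_mul_of_nonneg_left b1 hx0
    have h2 : y * |B| ≤ y * (M * (1 + α)) := by
      gcongr
      linarith
    linarith
  have c1 : ‖timeCoef' L ω α X V n t‖ ≤ M * (1 + α) * (1 + ω) * (x + y) * (1 + l) := by
    refine (norm_add_le _ _).trans ?_
    rw [norm_mul, norm_mul, Complex.norm_real, Complex.norm_real, Real.norm_eq_abs,
      Real.norm_eq_abs]
    have h1 : x * |-(waveNumber L n * ω) ^ 2 * B| ≤ x * (M * (1 + α) * (1 + ω) * (1 + l)) := by
      refine mul_le_mul_of_nonneg_left (b3.trans ?_) hx0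
      gcongr
      exact le_mul_of_one_le_right hM (by linarith)
    have h2 : y * |A - α / 2 * B| ≤ y * (M * (1 + α) * (1 + ω) * (1 + l)) := by
      refine mul_le_mul_of_nonneg_left (b2.trans ?_) hy0
      rw [mul_assoc (M * (1 + α))]
      exact le_mul_of_one_le_right (by positivity)
        (one_le_mul_of_one_le_of_one_le (by linarith) (by linarith))
    linarith
  have c2 : ‖timeCoef'' L ω α X V n t‖
      ≤ M * (1 + α) ^ 2 * (1 + ω) ^ 2 * (x + y) * (1 + l) ^ 2 := by
    refine (norm_sub_le _ _).trans ?_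
    rw [norm_mul, norm_mul, norm_neg, Complex.norm_real, Complex.norm_real, Real.norm_eq_abs,
      Real.norm_eq_abs, abs_of_nonneg hα, abs_pow, abs_mul, ← hl, abs_of_nonneg hω]
    set Q := M * (1 + α) * (x + y) with hQ
    have hQ0 : 0 ≤ Q := by positivity
    have h1 : α * ‖timeCoef' L ω α X V n t‖ ≤ α * (Q * ((1 + ω) * (1 + l)) ^ 2) := by
      refine mul_le_mul_of_nonneg_left (c1.trans ?_) hα
      have h0 : (1 : ℝ) ≤ (1 + ω) * (1 + l) :=
        one_le_mul_of_one_le_of_one_le (by linarith) (by linarith)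
      have : M * (1 + α) * (1 + ω) * (x + y) * (1 + l) = Q * ((1 + ω) * (1 + l)) := by
        rw [hQ]; ring
      rw [this]
      gcongr
      exact le_self_pow₀ h0 two_ne_zero
    have h2 : (l * ω) ^ 2 * ‖timeCoef L ω α X V n t‖ ≤ ((1 + l) * (1 + ω)) ^ 2 * Q := by
      gcongr <;> linarith
    have : M * (1 + α) ^ 2 * (1 + ω) ^ 2 * (x + y) * (1 + l) ^ 2
      = α * (Q * ((1 + ω) * (1 + l)) ^ 2) + ((1 + l) * (1 + ω)) ^ 2 * Q := by rw [hQ]; ring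
    linarith
  have hα1 : (1 : ℝ) ≤ 1 + α := by linarith
  have hω1 : (1 : ℝ) ≤ 1 + ω := by linarith
  refine ⟨c0.trans ?_, c1.trans ?_, c2⟩
  · gcongr ?_ * (x + y)
    calc M * (1 + α) ≤ M * (1 + α) ^ 2 := by gcongr; exact le_self_pow₀ hα1 two_ne_zero
      _ ≤ _ := le_mul_of_one_le_right (by positivity) (one_le_pow₀ hω1)
  · gcongr ?_ * (x + y) * (1 + l)
    gcongr
    · exact le_self_pow₀ hα1 two_ne_zero
    · exact le_self_pow₀ hω1 two_ne_zero

end Modes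

/-! ### Duhamel's formula for the spatially constant part. -/

section DampedPath

variable {α v : ℝ} {F : ℝ → ℝ}

/-- The solution of `P' = -α P + F` with `P 0 = v`. -/
def dampedVelocity (α v : ℝ) (F : ℝ → ℝ) (t : ℝ) : ℝ :=
  Real.exp (-α * t) * (v + ∫ s in (0 : ℝ)..t, Real.exp (α * s) * F s)

theorem hasDerivAt_dampedVelocity (hF : Continuous F) (t : ℝ) :
    HasDerivAt (dampedVelocity α v F) (-α * dampedVelocity α v F t + F t) t := by
  have hc : Continuous fun s => Real.exp (α * s) * F s := by fun_prop
  have h1 := ((hc.integral_hasStrictDerivAt 0 t).hasDerivAt).const_add v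
  have h2 : HasDerivAt (fun t : ℝ => Real.exp (-α * t)) (Real.exp (-α * t) * (-α)) t := by
    simpa using ((hasDerivAt_id t).const_mul (-α)).exp
  refine (h2.mul h1).congr_deriv ?_
  have h3 : Real.exp (-α * t) * Real.exp (α * t) = 1 := by
    rw [← Real.exp_add, show -α * t + α * t = 0 by ring, Real.exp_zero]
  rw [dampedVelocity]
  linear_combination F t * h3

theorem continuous_dampedVelocity (hF : Continuous F) : Continuous (dampedVelocity α v F) :=
  continuous_iff_continuousAt.2 fun t => (hasDerivAt_dampedVelocity hF t).continuousAt

@[simp] theorem dampedVelocity_zero (α v : ℝ) (F : ℝ → ℝ) : dampedVelocity α v F 0 = v := by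
  simp [dampedVelocity]

@[simp] theorem dampingKernel_zero (α : ℝ) : dampingKernel α 0 = 0 := by simp [dampingKernel]

theorem hasDerivAt_dampingKernel (α τ : ℝ) :
    HasDerivAt (dampingKernel α) (1 - α * dampingKernel α τ) τ := by
  by_cases h : α = 0
  · have : dampingKernel α = fun τ => τ := by ext; simp [dampingKernel, h]
    rw [this]
    exact (hasDerivAt_id τ).congr_deriv (by simp [h])
  · have : dampingKernel α = fun τ => (1 - Real.exp (-α * τ)) / α := by
      ext; simp [dampingKernel, h]
    rw [this]
    have h2 : HasDerivAt (fun t : ℝ => Real.exp (-α * t)) (Real.exp (-α * τ) * (-α)) τ := by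
      simpa using ((hasDerivAt_id τ).const_mul (-α)).exp
    refine ((h2.const_sub 1).div_const α).congr_deriv ?_
    field_simp
    ring

theorem continuous_dampingKernel (α : ℝ) : Continuous (dampingKernel α) :=
  continuous_iff_continuousAt.2 fun t => (hasDerivAt_dampingKernel α t).continuousAt

/-- Integrate `d/ds [κ(t-s) P(s)] = κ(t-s) F(s) - P(s)`, which follows from `κ' = 1 - ακ` and `P' =
-αP + F`. -/
theorem integral_dampedVelocity (hF : Continuous F) (t : ℝ) :
    ∫ s in (0 : ℝ)..t, dampedVelocity α v F s
      = dampingKernel α t * v + ∫ s in (0 : ℝ)..t, dampingKernel α (t - s) * F s := by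
  have hP := continuous_dampedVelocity (α := α) (v := v) hF
  have hK := continuous_dampingKernel α
  have hd : ∀ s, HasDerivAt (fun s => dampingKernel α (t - s) * dampedVelocity α v F s)
      (dampingKernel α (t - s) * F s - dampedVelocity α v F s) s := fun s => by
    have h1 := (hasDerivAt_dampingKernel α (t - s)).comp s ((hasDerivAt_id s).const_sub t)
    refine (h1.mul (hasDerivAt_dampedVelocity hF s)).congr_deriv ?_
    simp only [Function.comp_apply]
    ring
  have c1 : Continuous fun s => dampingKernel α (t - s) * F s := by fun_prop
  have := intervalIntegral.integral_eq_sub_of_hasDerivAt (a := 0) (b := t) (fun s _ => hd s)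
    ((c1.sub hP).intervalIntegrable _ _)
  rw [intervalIntegral.integral_sub (c1.intervalIntegrable _ _) (hP.intervalIntegrable _ _)] at this
  simp only [sub_self, sub_zero, dampingKernel_zero, zero_mul, dampedVelocity_zero] at this
  linarith

end DampedPath

/-! ### Construction of the wave solution. -/

section Existence

variable {L ω α v : ℝ} {X V f : ℝ → ℝ}

theorem isDominated_of_bounds {p q : ℤ → ℝ → ℂ} {s : ℤ → ℝ} {i j : ℕ} {K' : ℝ} (L : ℝ)
    (hs : ∀ n, 0 ≤ s n) (hsum : Summable fun n => (1 + |waveNumber L n|) ^ 2 * s n)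
    (hij : i + j ≤ 2)
    (hp : ∀ T, ∃ K, 0 ≤ K ∧ ∀ n t, |t| ≤ T → ‖p n t‖ ≤ K * s n * (1 + |waveNumber L n|) ^ i)
    (hK' : 0 ≤ K') (hq : ∀ n z, ‖q n z‖ ≤ K' * (1 + |waveNumber L n|) ^ j) : IsDominated p q := by
  intro T
  obtain ⟨K, hK, hb⟩ := hp T
  refine ⟨fun n => K * K' * ((1 + |waveNumber L n|) ^ 2 * s n), hsum.mul_left _,
    fun n t z ht => ?_⟩
  have h1 : (1 : ℝ) ≤ 1 + |waveNumber L n| := le_add_of_nonneg_right (abs_nonneg _)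
  have hsn := hs n
  rw [norm_mul]
  calc ‖p n t‖ * ‖q n z‖
      ≤ (K * s n * (1 + |waveNumber L n|) ^ i) * (K' * (1 + |waveNumber L n|) ^ j) := by
        gcongr
        · exact hb n t ht
        · exact hq n z
    _ = K * K' * ((1 + |waveNumber L n|) ^ (i + j) * s n) := by ring
    _ ≤ _ := mul_le_mul_of_nonneg_left
        (mul_le_mul_of_nonneg_right (pow_le_pow_right₀ h1 hij) hsn) (by positivity)

theorem IsProfile.summable_weight (hL : 0 < L) (h : IsProfile L X V) :
    Summable fun n => (1 + |waveNumber L n|) ^ 2 *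
      (‖fourierCoef L X n‖ + ‖fourierCoef L V n‖) := by
  simp only [mul_add]
  exact (summable_weight_mul_norm_fourierCoef hL h.contDiff_X h.periodic_X).add
    (summable_weight_mul_norm_fourierCoef hL h.contDiff_V h.periodic_V)

theorem IsProfile.isDominated (hL : 0 < L) (hω : 0 ≤ ω) (hα : 0 ≤ α) (h : IsProfile L X V) :
    IsDominated (timeCoef L ω α X V) (spacePrim L) ∧
    IsDominated (timeCoef L ω α X V) (spaceMode L) ∧
    IsDominated (timeCoef L ω α X V) (spaceMode' L) ∧
    IsDominated (timeCoef' L ω α X V) (spacePrim L) ∧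
    IsDominated (timeCoef' L ω α X V) (spaceMode L) ∧
    IsDominated (timeCoef'' L ω α X V) (spacePrim L) := by
  have hs : ∀ n, 0 ≤ ‖fourierCoef L X n‖ + ‖fourierCoef L V n‖ := fun n => by positivity
  have hsum := h.summable_weight hL
  have p0 : ∀ T, ∃ K, 0 ≤ K ∧ ∀ n t, |t| ≤ T → ‖timeCoef L ω α X V n t‖
      ≤ K * (‖fourierCoef L X n‖ + ‖fourierCoef L V n‖) * (1 + |waveNumber L n|) ^ 0 := fun T => by
    obtain ⟨K, hK, hb⟩ := exists_timeCoef_bound L X V hα hω T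
    exact ⟨K, hK, fun n t ht => by simpa using (hb n t ht).1⟩
  have p1 : ∀ T, ∃ K, 0 ≤ K ∧ ∀ n t, |t| ≤ T → ‖timeCoef' L ω α X V n t‖
      ≤ K * (‖fourierCoef L X n‖ + ‖fourierCoef L V n‖) * (1 + |waveNumber L n|) ^ 1 := fun T => by
    obtain ⟨K, hK, hb⟩ := exists_timeCoef_bound L X V hα hω T
    exact ⟨K, hK, fun n t ht => by simpa using (hb n t ht).2.1⟩
  have p2 : ∀ T, ∃ K, 0 ≤ K ∧ ∀ n t, |t| ≤ T → ‖timeCoef'' L ω α X V n t‖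
      ≤ K * (‖fourierCoef L X n‖ + ‖fourierCoef L V n‖) * (1 + |waveNumber L n|) ^ 2 := fun T => by
    obtain ⟨K, hK, hb⟩ := exists_timeCoef_bound L X V hα hω T
    exact ⟨K, hK, fun n t ht => (hb n t ht).2.2⟩
  have q0 : ∀ n z, ‖spacePrim L n z‖ ≤ L * (1 + |waveNumber L n|) ^ 0 := fun n z => by
    simpa using norm_spacePrim_le hL n z
  have q1 : ∀ n z, ‖spaceMode L n z‖ ≤ 1 * (1 + |waveNumber L n|) ^ 0 := fun n z => by
    simpa using norm_spaceMode_le L n z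
  have q2 : ∀ n z, ‖spaceMode' L n z‖ ≤ 1 * (1 + |waveNumber L n|) ^ 1 := fun n z => by
    rw [norm_spaceMode', one_mul, pow_one]
    linarith
  exact ⟨isDominated_of_bounds L hs hsum (by norm_num) p0 hL.le q0,
    isDominated_of_bounds L hs hsum (by norm_num) p0 zero_le_one q1,
    isDominated_of_bounds L hs hsum (by norm_num) p0 zero_le_one q2,
    isDominated_of_bounds L hs hsum (by norm_num) p1 hL.le q0,
    isDominated_of_bounds L hs hsum (by norm_num) p1 zero_le_one q1,
    isDominated_of_bounds L hs hsum (by norm_num) p2 hL.le q0⟩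

theorem deviationTerm_eq (L ω α : ℝ) (X V : ℝ → ℝ) (t x : ℝ) (n : ℤ) :
    deviationTerm L ω α X V t x n = timeCoef L ω α X V n t * spaceMode L n x := by
  by_cases hn : n = 0
  · simp [deviationTerm, spaceMode, hn]
  · simp only [deviationTerm, spaceMode, timeCoef, hn, if_false]
    ring

theorem deviationTerm_neg (L ω α : ℝ) (X V : ℝ → ℝ) (t x : ℝ) (n : ℤ) :
    deviationTerm L ω α X V t x (-n) = (starRingEnd ℂ) (deviationTerm L ω α X V t x n) := by
  by_cases hn : n = 0
  · simp [deviationTerm, hn]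
  · simp only [deviationTerm, neg_eq_zero, hn, if_false, map_mul, map_add, modeA_neg, modeB_neg,
      fourierCoef_neg, Complex.conj_ofReal, ← Complex.exp_conj, waveNumber_neg, map_neg,
      Complex.conj_I]
    push_cast
    ring_nf

/-- Terms `n` and `-n` are conjugate, so the sum is real and the real parts taken in `modeSum` lose
nothing. -/
theorem hasSum_deviationTerm (hL : 0 < L) (hω : 0 ≤ ω) (hα : 0 ≤ α) (h : IsProfile L X V)
    (t x : ℝ) : HasSum (deviationTerm L ω α X V t x)
      (modeSum (timeCoef L ω α X V) (spaceMode L) t x : ℂ) := by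
  obtain ⟨-, hd, -⟩ := h.isDominated hL hω hα
  have h1 : HasSum (deviationTerm L ω α X V t x) (∑' n, deviationTerm L ω α X V t x n) := by
    refine Summable.hasSum ?_
    simp only [funext (deviationTerm_eq L ω α X V t x)]
    exact hd.summable t x
  set S := ∑' n, deviationTerm L ω α X V t x n with hS
  have h2 : HasSum (deviationTerm L ω α X V t x) ((starRingEnd ℂ) S) := by
    rw [← (Equiv.neg ℤ).hasSum_iff]
    have : deviationTerm L ω α X V t x ∘ Equiv.neg ℤ
        = fun n => (starRingEnd ℂ) (deviationTerm L ω α X V t x n) :=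
      funext fun n => deviationTerm_neg L ω α X V t x n
    rw [this]
    exact Complex.hasSum_conj'.2 (by simpa using h1)
  have h3 : ((S.re : ℝ) : ℂ) = S := Complex.conj_eq_iff_re.1 (h2.unique h1)
  have h4 : modeSum (timeCoef L ω α X V) (spaceMode L) t x = S.re := by
    rw [modeSum, ← (Complex.hasSum_re h1).tsum_eq]
    exact tsum_congr fun n => by rw [deviationTerm_eq]
  rw [h4, h3]
  exact h1

theorem tsum_re_fourierCoef_mul_spaceMode {h : ℝ → ℝ} (hL : 0 < L) (hh : ContDiff ℝ 4 h)
    (hp : Function.Periodic h L) (z : ℝ) :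
    ∑' n, (fourierCoef L h n * spaceMode L n z).re = h z - 1 / L * ∫ u in (0 : ℝ)..L, h u := by
  have h1 := (hasSum_fourierCoef hL hh hp z).sub (hasSum_ite_eq (0 : ℤ) (fourierCoef L h 0))
  have h2 : HasSum (fun n => fourierCoef L h n * spaceMode L n z)
      (h z - fourierCoef L h 0 : ℂ) := by
    have : ∀ n, fourierCoef L h n * spaceMode L n z
        = Complex.exp (-Complex.I * (waveNumber L n * z : ℝ)) * fourierCoef L h n
          - if n = 0 then fourierCoef L h 0 else 0 := fun n => by
      by_cases hn : n = 0
      · simp [hn, spaceMode]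
      · simp only [spaceMode, hn, if_false, sub_zero]
        ring
    simpa only [funext this] using h1
  rw [(Complex.hasSum_re h2).tsum_eq, fourierCoef_zero]
  simp

theorem timeCoef_zero (L ω α : ℝ) (X V : ℝ → ℝ) (n : ℤ) :
    timeCoef L ω α X V n 0 = fourierCoef L X n := by simp [timeCoef]

theorem timeCoef'_zero (L ω α : ℝ) (X V : ℝ → ℝ) (n : ℤ) :
    timeCoef' L ω α X V n 0 = fourierCoef L V n := by simp [timeCoef']

/-- The damped path is driven by `f + ω² R_z(t,0)`, exactly what `hpde` leaves over, and it carries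
the initial velocity `v`. -/
theorem isWaveSolution_of_deviation (hf : Continuous f) 
    {W Wt Wtt R Rz Rt : ℝ → ℝ → ℝ}
    (dW_t : ∀ t z, HasDerivAt (fun s => W s z) (Wt t z) t)
    (dWt_t : ∀ t z, HasDerivAt (fun s => Wt s z) (Wtt t z) t)
    (dW_z : ∀ t z, HasDerivAt (W t) (R t z) z)
    (dWt_z : ∀ t z, HasDerivAt (Wt t) (Rt t z) z)
    (dR_t : ∀ t z, HasDerivAt (fun s => R s z) (Rt t z) t)
    (dR_z : ∀ t z, HasDerivAt (R t) (Rz t z) z)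
    (c11 : Continuous fun p : ℝ × ℝ => Rt p.1 p.2)
    (c02 : Continuous fun p : ℝ × ℝ => Rz p.1 p.2)
    (c20 : Continuous fun p : ℝ × ℝ => Wtt p.1 p.2)
    (hpde : ∀ t z, Wtt t z = -α * Wt t z + ω ^ 2 * (Rz t z - Rz t 0))
    (hW0 : ∀ z, W 0 z = (∫ u in (0 : ℝ)..z, X u) - z)
    (hWt0 : ∀ z, Wt 0 z = ∫ u in (0 : ℝ)..z, V u)
    (hper : ∀ t z, W t (z + L) = W t z) :
    IsWaveSolution L ω α f X V v (fun t z =>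
      (∫ s in (0 : ℝ)..t, dampedVelocity α v (fun s => f s + ω ^ 2 * Rz s 0) s) + z + W t z) := by
  have cRz0 : Continuous fun s => Rz s 0 :=
    c02.comp (by fun_prop : Continuous fun s : ℝ => (s, (0 : ℝ)))
  set F : ℝ → ℝ := fun s => f s + ω ^ 2 * Rz s 0 with hF
  have cF : Continuous F := hf.add (continuous_const.mul cRz0)
  set P := dampedVelocity α v F with hP
  have dP : ∀ t, HasDerivAt P (-α * P t + F t) t := hasDerivAt_dampedVelocity cF
  have cP : Continuous P := continuous_dampedVelocity cF
  set g : ℝ → ℝ := fun t => ∫ s in (0 : ℝ)..t, P s with hg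
  have dg : ∀ t, HasDerivAt g (P t) t := fun t => (cP.integral_hasStrictDerivAt 0 t).hasDerivAt
  set G : ℝ → ℝ → ℝ := fun t z => g t + z + W t z with hG
  have dG_t : ∀ t z, HasDerivAt (fun s => G s z) (P t + Wt t z) t := fun t z =>
    ((dg t).add_const z).fun_add (dW_t t z)
  have dG_tt : ∀ t z, HasDerivAt (fun s => P s + Wt s z) (-α * P t + F t + Wtt t z) t :=
    fun t z => (dP t).fun_add (dWt_t t z)
  have dG_z : ∀ t z, HasDerivAt (G t) (1 + R t z) z := fun t z =>
    ((hasDerivAt_id z).const_add (g t)).fun_add (dW_z t z)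
  have dG_zz : ∀ t z, HasDerivAt (fun z => 1 + R t z) (Rz t z) z := fun t z =>
    (dR_z t z).const_add 1
  have hu := uniqueDiffOn_Ici (0 : ℝ)
  have dwG : ∀ z, ∀ t ∈ Ici (0 : ℝ), derivWithin (fun s => G s z) (Ici 0) t = P t + Wt t z :=
    fun z t ht => (dG_t t z).hasDerivWithinAt.derivWithin (hu t ht)
  refine ⟨?_, ?_, ?_, ?_, ?_⟩
  -- The formula makes sense for negative times too, so `C²` is proved on the whole plane from
  -- continuous second partials.
  · refine ContDiff.contDiffOn ?_
    have e1 : ContDiff ℝ (1 : ℕ) fun x : ℝ × ℝ => P x.1 + Wt x.1 x.2 := by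
      have := contDiff_succ_of_partials (n := 0) (F := fun t z => P t + Wt t z) dG_tt
        (fun t z => (dWt_z t z).const_add (P t)) (contDiff_zero.2 ?_) (contDiff_zero.2 c11)
      · simpa using this
      · exact (((continuous_const.mul cP).add cF).comp continuous_fst).add c20
    have e2 : ContDiff ℝ (1 : ℕ) fun x : ℝ × ℝ => 1 + R x.1 x.2 := by
      have := contDiff_succ_of_partials (n := 0) (F := fun t z => 1 + R t z)
        (fun t z => (dR_t t z).const_add 1) dG_zz (contDiff_zero.2 c11) (contDiff_zero.2 c02)
      simpa using this
    have := contDiff_succ_of_partials (n := 1) dG_t dG_z e1 e2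
    norm_num at this
    exact this
  · intro t ht z
    rw [dwG z t ht, iteratedDerivWithin_succ, iteratedDerivWithin_one,
      derivWithin_congr (dwG z) (dwG z t ht),
      (dG_tt t z).hasDerivWithinAt.derivWithin (hu t ht), iteratedDeriv_succ, iteratedDeriv_one]
    have : deriv (fun w => G t w) = fun w => 1 + R t w := funext fun w => (dG_z t w).deriv
    rw [this, (dG_zz t z).deriv, hpde, hF]
    ring
  · intro z
    simp only [hG, hg, hW0, intervalIntegral.integral_same]
    ring
  · intro z
    rw [dwG z 0 self_mem_Ici, hP, dampedVelocity_zero, hWt0]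
  · intro t _ z
    simp only [hG, hper]
    ring

theorem wave_equation_modeSum (hL : 0 < L) (hω : 0 ≤ ω) (hα : 0 ≤ α) (h : IsProfile L X V)
    (t z : ℝ) : modeSum (timeCoef'' L ω α X V) (spacePrim L) t z
      = -α * modeSum (timeCoef' L ω α X V) (spacePrim L) t z
        + ω ^ 2 * (modeSum (timeCoef L ω α X V) (spaceMode' L) t z
          - modeSum (timeCoef L ω α X V) (spaceMode' L) t 0) := by
  obtain ⟨-, -, d02, d10, -, -⟩ := h.isDominated (ω := ω) (α := α) hL hω hα
  unfold modeSum
  rw [← (d02.summable_re t z).tsum_sub (d02.summable_re t 0), ← tsum_mul_left, ← tsum_mul_left,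
    ← ((d10.summable_re t z).mul_left _).tsum_add
      (((d02.summable_re t z).sub (d02.summable_re t 0)).mul_left _)]
  refine tsum_congr fun n => ?_
  have h1 := congrArg (fun c => timeCoef L ω α X V n t * c) (spaceMode'_sub L n z)
  have h2 : timeCoef'' L ω α X V n t * spacePrim L n z
      = ((-α : ℝ) : ℂ) * (timeCoef' L ω α X V n t * spacePrim L n z)
      + ((ω ^ 2 : ℝ) : ℂ) * (timeCoef L ω α X V n t * spaceMode' L n z
        - timeCoef L ω α X V n t * spaceMode' L n 0) := by
    simp only [timeCoef'']
    push_cast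
    linear_combination (-(ω : ℂ) ^ 2) * h1
  rw [h2, Complex.add_re, Complex.re_ofReal_mul, Complex.re_ofReal_mul, Complex.sub_re]

theorem modeSum_spacePrim {p : ℤ → ℝ → ℂ} (hL : 0 < L) (hp : ∀ n, Continuous (p n))
    (d0 : IsDominated p (spacePrim L)) (d1 : IsDominated p (spaceMode L)) (t z : ℝ) :
    ∫ y in (0 : ℝ)..z, modeSum p (spaceMode L) t y = modeSum p (spacePrim L) t z := by
  have hc : Continuous (modeSum p (spaceMode L) t) :=
    (d1.continuous hp fun n => continuous_iff_continuousAt.2 fun t =>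
      (hasDerivAt_spaceMode L n t).continuousAt).comp (by fun_prop : Continuous fun z => (t, z))
  rw [intervalIntegral.integral_eq_sub_of_hasDerivAt
    (fun y _ => d0.hasDerivAt_snd d1 (hasDerivAt_spacePrim hL) t y) (hc.intervalIntegrable _ _)]
  simp [modeSum]

theorem exists_isWaveSolution (hL : 0 < L) (hω : 0 ≤ ω) (hα : 0 ≤ α) (hf : Continuous f)
    (h : IsProfile L X V) (v : ℝ) :
    ∃ G r : ℝ → ℝ → ℝ, IsWaveSolution L ω α f X V v G ∧
      (∀ t y, HasSum (deviationTerm L ω α X V t y) (r t y : ℂ)) ∧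
      (∀ t z, G t z = G t 0 + z + ∫ y in (0 : ℝ)..z, r t y) ∧
      (∀ t, G t 0 = dampingKernel α t * v + (∫ s in (0 : ℝ)..t, dampingKernel α (t - s) * f s)
        + ω ^ 2 * ∫ s in (0 : ℝ)..t, dampingKernel α (t - s) * deriv (fun y => r s y) 0) := by
  obtain ⟨d00, d01, d02, d10, d11, d20⟩ := h.isDominated (ω := ω) (α := α) hL hω hα
  have hp0 := hasDerivAt_timeCoef L ω α X V
  have hp1 := hasDerivAt_timeCoef' L ω α X V
  have hq0 := hasDerivAt_spacePrim hL
  have hq1 := hasDerivAt_spaceMode L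
  have cp0 : ∀ n, Continuous (timeCoef L ω α X V n) := fun n =>
    continuous_iff_continuousAt.2 fun t => (hp0 n t).continuousAt
  have cp1 : ∀ n, Continuous (timeCoef' L ω α X V n) := fun n =>
    continuous_iff_continuousAt.2 fun t => (hp1 n t).continuousAt
  have cp2 : ∀ n, Continuous (timeCoef'' L ω α X V n) := fun n =>
    (continuous_const.mul (cp1 n)).sub (continuous_const.mul (cp0 n))
  have cq0 : ∀ n, Continuous (spacePrim L n) := fun n =>
    continuous_iff_continuousAt.2 fun t => (hq0 n t).continuousAt
  have cq1 : ∀ n, Continuous (spaceMode L n) := fun n =>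
    continuous_iff_continuousAt.2 fun t => (hq1 n t).continuousAt
  have cq2 : ∀ n, Continuous (spaceMode' L n) := fun n => by unfold spaceMode'; fun_prop
  have c02 := d02.continuous cp0 cq2
  have hW := modeSum_spacePrim hL cp0 d00 d01
  have hWt := modeSum_spacePrim hL cp1 d10 d11
  have hW0 : ∀ z, modeSum (timeCoef L ω α X V) (spacePrim L) 0 z
      = (∫ u in (0 : ℝ)..z, X u) - z := fun z => by
    -- The missing zero mode is the mean of `X`, which is `1`; it accounts for the summand `z` in
    -- `G`.
    have : ∀ y, modeSum (timeCoef L ω α X V) (spaceMode L) 0 y = X y - 1 := fun y => by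
      simp only [modeSum, timeCoef_zero]
      rw [tsum_re_fourierCoef_mul_spaceMode hL h.contDiff_X h.periodic_X, h.integral_X,
        one_div_mul_cancel hL.ne']
    rw [← hW]
    simp only [this]
    rw [intervalIntegral.integral_sub (h.contDiff_X.continuous.intervalIntegrable _ _) (by simp),
      intervalIntegral.integral_const]
    simp
  have hWt0 : ∀ z, modeSum (timeCoef' L ω α X V) (spacePrim L) 0 z
      = ∫ u in (0 : ℝ)..z, V u := fun z => by
    have : ∀ y, modeSum (timeCoef' L ω α X V) (spaceMode L) 0 y = V y := fun y => by
      simp only [modeSum, timeCoef'_zero]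
      rw [tsum_re_fourierCoef_mul_spaceMode hL h.contDiff_V h.periodic_V, h.integral_V]
      ring
    rw [← hWt]
    simp only [this]
  have hper : ∀ t z, modeSum (timeCoef L ω α X V) (spacePrim L) t (z + L)
      = modeSum (timeCoef L ω α X V) (spacePrim L) t z := fun t z => by
    have : ∀ n, spacePrim L n (z + L) = spacePrim L n z := fun n => by
      rw [spacePrim, spacePrim, exp_neg_waveNumber_add_period hL]
    simp only [modeSum, this]
  have hz0 : ∀ t, modeSum (timeCoef L ω α X V) (spacePrim L) t 0 = 0 := fun t => by simp [modeSum]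
  have dR_z := d01.hasDerivAt_snd d02 hq1
  refine ⟨_, modeSum (timeCoef L ω α X V) (spaceMode L),
    isWaveSolution_of_deviation hf (d00.hasDerivAt_fst d10 hp0)
      (d10.hasDerivAt_fst d20 hp1) (d00.hasDerivAt_snd d01 hq0) (d10.hasDerivAt_snd d11 hq0)
      (d01.hasDerivAt_fst d11 hp0) dR_z (d11.continuous cp1 cq1) c02
      (d20.continuous cp2 cq0) (wave_equation_modeSum hL hω hα h) hW0 hWt0 hper,
    hasSum_deviationTerm hL hω hα h, fun t z => ?_, fun t => ?_⟩
  · rw [hW, hz0]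
    ring
  · have c1 : Continuous fun s => dampingKernel α (t - s) :=
      (continuous_dampingKernel α).comp (by fun_prop)
    have cRz0 : Continuous fun s => modeSum (timeCoef L ω α X V) (spaceMode' L) s 0 := by
      have := c02.comp (by fun_prop : Continuous fun s : ℝ => (s, (0 : ℝ)))
      simpa only [Function.comp_def] using this
    have hRe : ∀ s, deriv (fun y => modeSum (timeCoef L ω α X V) (spaceMode L) s y) 0
      = modeSum (timeCoef L ω α X V) (spaceMode' L) s 0 := fun s => (dR_z s 0).deriv
    simp only [hRe, hz0, add_zero]
    have cF : Continuous fun s =>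
        f s + ω ^ 2 * modeSum (timeCoef L ω α X V) (spaceMode' L) s 0 :=
      hf.add (continuous_const.mul cRz0)
    have i1 : IntervalIntegrable (fun s => dampingKernel α (t - s) * f s) volume 0 t :=
      (c1.mul hf).intervalIntegrable _ _
    have i2 : IntervalIntegrable (fun s => ω ^ 2 * (dampingKernel α (t - s) *
        modeSum (timeCoef L ω α X V) (spaceMode' L) s 0)) volume 0 t :=
      (continuous_const.mul (c1.mul cRz0)).intervalIntegrable _ _
    rw [integral_dampedVelocity cF, add_assoc,
      ← intervalIntegral.integral_const_mul,
      ← intervalIntegral.integral_add i1 i2]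
    congr 1
    refine intervalIntegral.integral_congr fun s _ => ?_
    ring

end Existence

/-! ### Labels, nodes and passage to the limit. -/

section ContinuumLimit

variable {L : ℝ} {X : ℝ → ℝ} {G : ℝ → ℝ → ℝ}

theorem exists_pos_le_of_periodic (hL : 0 < L) (hX : Continuous X) (hp : Function.Periodic X L)
    (hpos : ∀ u, 0 < X u) : ∃ m, 0 < m ∧ ∀ u, m ≤ X u := by
  obtain ⟨u₀, -, hu₀⟩ := isCompact_Icc.exists_isMinOn (nonempty_Icc.2 hL.le) hX.continuousOn
  refine ⟨X u₀, hpos u₀, fun u => ?_⟩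
  obtain ⟨w, hw, hwu⟩ := hp.exists_mem_Ico₀ hL u
  rw [hwu]
  exact hu₀ (Ico_subset_Icc_self hw)

theorem mul_sub_le_integral_sub (hX : Continuous X) {m a b : ℝ} (hm : ∀ u, m ≤ X u) (hab : a ≤ b) :
    m * (b - a) ≤ (∫ u in (0 : ℝ)..b, X u) - ∫ u in (0 : ℝ)..a, X u := by
  rw [intervalIntegral.integral_interval_sub_left (hX.intervalIntegrable _ _)
    (hX.intervalIntegrable _ _)]
  have := intervalIntegral.integral_mono_on hab
    (by simp : IntervalIntegrable (fun _ => m) volume a b) (hX.intervalIntegrable _ _) fun u _ => hm u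
  rwa [intervalIntegral.integral_const, smul_eq_mul, mul_comm] at this

theorem strictMono_integral (hX : Continuous X) {m : ℝ} (hm0 : 0 < m) (hm : ∀ u, m ≤ X u) :
    StrictMono fun w => ∫ u in (0 : ℝ)..w, X u := fun a b hab => by
  have := mul_sub_le_integral_sub hX hm hab.le
  have h2 : 0 < m * (b - a) := mul_pos hm0 (sub_pos.2 hab)
  simp only
  linarith

theorem surjective_integral (hX : Continuous X) {m : ℝ} (hm0 : 0 < m) (hm : ∀ u, m ≤ X u) :
    Function.Surjective fun w => ∫ u in (0 : ℝ)..w, X u := by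
  refine (intervalIntegral.continuous_primitive (fun a b => hX.intervalIntegrable a b) 0).surjective
    ?_ ?_
  · refine tendsto_atTop_mono' atTop ?_ (tendsto_id.const_mul_atTop hm0)
    filter_upwards [eventually_ge_atTop 0] with w hw
    simpa using mul_sub_le_integral_sub hX hm hw
  · refine tendsto_atBot_mono' atBot ?_ (tendsto_id.const_mul_atBot hm0)
    filter_upwards [eventually_le_atBot 0] with w hw
    have := mul_sub_le_integral_sub hX hm hw
    simp only [intervalIntegral.integral_same] at this
    simp only [id]
    linarith

/-- Quasi-periodicity gives `a(mN) = a(0) + mL`, so `a` is unbounded in both directions and a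
greatest `j` with `a j ≤ y` exists. -/
theorem exists_index_of_strictMono (hL : 0 < L) {a : ℤ → ℝ} (ha : StrictMono a) {N : ℕ} (hN : 0 < N)
    (hp : ∀ k, a (k + N) = a k + L) (y : ℝ) : ∃ j, a j ≤ y ∧ y < a (j + 1) := by
  have hN' : (N : ℝ) ≠ 0 := by exact_mod_cast hN.ne'
  have hF : Function.Periodic (fun k : ℤ => a k - k * L / N) (N : ℤ) := fun k => by
    simp only [hp]
    push_cast
    field_simp
    ring
  have hmul : ∀ m : ℤ, a (m * N) = a 0 + m * L := fun m => by
    have := hF.int_mul_eq m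
    simp only [Int.cast_mul, Int.cast_natCast, Int.cast_zero, zero_mul, zero_div, sub_zero,
      Int.cast_id] at this
    have h2 : (m : ℝ) * N * L / N = m * L := by field_simp
    linarith
  obtain ⟨m₁, hm₁⟩ := exists_int_gt ((y - a 0) / L)
  obtain ⟨m₂, hm₂⟩ := exists_int_lt ((y - a 0) / L)
  rw [div_lt_iff₀ hL] at hm₁
  rw [lt_div_iff₀ hL] at hm₂
  obtain ⟨j, hj, hmax⟩ := Int.exists_greatest_of_bdd (P := fun j => a j ≤ y)
    ⟨m₁ * N, fun z hz => by
      refine (ha.lt_iff_lt.1 (hz.trans_lt ?_)).le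
      rw [hmul]
      linarith⟩
    ⟨m₂ * N, by rw [hmul]; linarith⟩
  refine ⟨j, hj, lt_of_not_ge fun h => ?_⟩
  have := hmax _ h
  omega

theorem index_unique_of_strictMono {a : ℤ → ℝ} (ha : StrictMono a) {y : ℝ} {i j : ℤ}
    (hi : a i ≤ y ∧ y < a (i + 1)) (hj : a j ≤ y ∧ y < a (j + 1)) : i = j := by
  have h1 := ha.lt_iff_lt.1 (hi.1.trans_lt hj.2)
  have h2 := ha.lt_iff_lt.1 (hj.1.trans_lt hi.2)
  omega

theorem abs_floor_node_sub_le (hL : 0 < L) {N : ℕ} (hN : 0 < N) (z : ℝ) :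
    |(⌊z * N / L⌋ : ℝ) * L / N - z| ≤ L / N := by
  have hN' : (0 : ℝ) < N := by exact_mod_cast hN
  have h1 := Int.floor_le (z * N / L)
  have h2 := Int.lt_floor_add_one (z * N / L)
  have h3 : (⌊z * N / L⌋ : ℝ) * L / N - z = (⌊z * N / L⌋ - z * N / L) * (L / N) := by
    field_simp
  rw [h3, abs_mul, abs_of_pos (by positivity : 0 < L / N)]
  refine mul_le_of_le_one_left (by positivity) (abs_le.2 ⟨?_, ?_⟩) <;> linarith

theorem tendsto_floor_node (hL : 0 < L) (z : ℝ) :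
    Tendsto (fun N : ℕ => (⌊z * N / L⌋ : ℝ) * L / N) atTop (𝓝 z) := by
  rw [tendsto_iff_norm_sub_tendsto_zero]
  refine squeeze_zero' (Eventually.of_forall fun _ => norm_nonneg _) ?_
    (tendsto_const_div_atTop_nhds_zero_nat L)
  filter_upwards [eventually_gt_atTop 0] with N hN
  exact abs_floor_node_sub_le hL hN z

/-- The positions `x N k t` are, for large `N`, uniformly close to the values of `G` at the nodes
`k L / N`. -/
def IsContinuumLimit (L : ℝ) (x : ℕ → ℤ → ℝ → ℝ) (G : ℝ → ℝ → ℝ) : Prop :=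
  ∀ T ε : ℝ, 0 < ε →
    ∀ᶠ N : ℕ in atTop, ∀ k : ℤ, ∀ t ∈ Icc 0 T, |x N k t - G t (k * L / N)| < ε

/-- Both functions are, at `(t, z)`, the limit of the same sequence `x N ⌊zN/L⌋ t`. This yields
uniqueness for the wave equation. -/
theorem IsContinuumLimit.unique {x : ℕ → ℤ → ℝ → ℝ} {H : ℝ → ℝ → ℝ} (hL : 0 < L)
    (hG : IsContinuumLimit L x G) (hH : IsContinuumLimit L x H) {t : ℝ} (ht : 0 ≤ t)
    (cG : Continuous (G t)) (cH : Continuous (H t)) (z : ℝ) : H t z = G t z := by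
  have hlim : ∀ {K : ℝ → ℝ → ℝ}, IsContinuumLimit L x K → Continuous (K t) →
      Tendsto (fun N : ℕ => x N ⌊z * N / L⌋ t) atTop (𝓝 (K t z)) := fun {K} hK cK => by
    have h1 : Tendsto (fun N : ℕ => K t ((⌊z * N / L⌋ : ℝ) * L / N)) atTop (𝓝 (K t z)) :=
      (cK.tendsto z).comp (tendsto_floor_node hL z)
    have h2 : Tendsto (fun N : ℕ => x N ⌊z * N / L⌋ t - K t ((⌊z * N / L⌋ : ℝ) * L / N))
        atTop (𝓝 0) := by
      rw [Metric.tendsto_nhds]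
      intro ε hε
      filter_upwards [hK t ε hε] with N hN
      rw [Real.dist_0_eq_abs]
      exact hN _ t ⟨ht, le_rfl⟩
    simpa using h2.add h1
  exact tendsto_nhds_unique (hlim hH cH) (hlim hG cG)

theorem IsContinuumLimit.near {x : ℕ → ℤ → ℝ → ℝ} (hL : 0 < L) (hG : IsContinuumLimit L x G)
    (cG : ContinuousOn (fun p : ℝ × ℝ => G p.1 p.2) (Ici 0 ×ˢ univ)) (T : ℝ) {ε : ℝ}
    (hε : 0 < ε) : ∃ d, 0 < d ∧ ∀ᶠ N : ℕ in atTop, ∀ k : ℤ, ∀ t ∈ Icc 0 T, ∀ z ∈ Icc 0 L,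
      |k * L / N - z| < d → |x N k t - G t z| < ε := by
  have huc : UniformContinuousOn (fun p : ℝ × ℝ => G p.1 p.2) (Icc 0 T ×ˢ Icc (-L) (2 * L)) :=
    (isCompact_Icc.prod isCompact_Icc).uniformContinuousOn_of_continuous
      (cG.mono (prod_mono Icc_subset_Ici_self (subset_univ _)))
  obtain ⟨d, hd, H⟩ := Metric.uniformContinuousOn_iff.1 huc (ε / 2) (half_pos hε)
  -- The cap `L` keeps the node inside `[-L, 2L]`, where uniform continuity is available.
  refine ⟨min d L, lt_min hd hL, ?_⟩
  filter_upwards [hG T (ε / 2) (half_pos hε)] with N hN k t ht z hz hk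
  have h1 := hN k t ht
  have h2 := abs_lt.1 (hk.trans_le (min_le_right d L))
  have h3 := H (t, (k : ℝ) * L / N) ⟨ht, by constructor <;> linarith [hz.1, hz.2]⟩ (t, z)
    ⟨ht, by constructor <;> linarith [hz.1, hz.2]⟩ (by
      rw [Prod.dist_eq, dist_self, max_eq_right dist_nonneg]
      exact hk.trans_le (min_le_left d L))
  rw [Real.dist_eq] at h3
  have := abs_sub_le (x N k t) (G t (k * L / N)) (G t z)
  simp only at h3
  linarith

end ContinuumLimit

end StringChain

end

/-! ### The main theorem. -/

theorem mainTheorem7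
    (L ω₀ α : ℝ) (hL : 0 < L) (hω₀ : 0 < ω₀) (hα : 0 ≤ α)
    (f : ℝ → ℝ) (hf : ContDiff ℝ 2 f)
    (X V : ℝ → ℝ) (hXV : StringChain.IsProfile L X V)
    (C₁ C₂ δ : ℝ) (hC₁ : 0 < C₁) (hC₂ : 0 < C₂) (hδ0 : 0 < δ) (hδ1 : δ < 1)
    (hγ : StringChain.gammaConst L ω₀ α X V C₁ C₂ < δ)
    (v : ℝ) (x xdot : ℕ → ℤ → ℝ → ℝ)
    (hmotion : ∀ᶠ N : ℕ in atTop, StringChain.IsMotion L (ω₀ * N) α f N (x N) (xdot N))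
    (hinit : ∀ᶠ N : ℕ in atTop, StringChain.FollowsProfile L X V C₁ C₂ N
      (fun k => x N k 0) (fun k => xdot N k 0))
    (hv : ∀ᶠ N : ℕ in atTop, xdot N 0 0 = v) :
    ∃ (G r : ℝ → ℝ → ℝ) (zeta : ℝ → ℝ) (kidx : ℕ → ℝ → ℤ),
      -- `G` is the unique solution of the wave equation
      StringChain.IsWaveSolution L (ω₀ * L) α f X V v G ∧
      (∀ H : ℝ → ℝ → ℝ, StringChain.IsWaveSolution L (ω₀ * L) α f X V v H →
        ∀ t : ℝ, 0 ≤ t → ∀ z : ℝ, H t z = G t z) ∧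
      -- the explicit form of `G`
      (∀ t : ℝ, 0 ≤ t → ∀ y : ℝ,
        HasSum (StringChain.deviationTerm L (ω₀ * L) α X V t y) (r t y : ℂ)) ∧
      (∀ t : ℝ, 0 ≤ t → ∀ z : ℝ, G t z = G t 0 + z + ∫ y in (0 : ℝ)..z, r t y) ∧
      (∀ t : ℝ, 0 ≤ t → G t 0 = StringChain.dampingKernel α t * v
        + (∫ s in (0 : ℝ)..t, StringChain.dampingKernel α (t - s) * f s)
        + (ω₀ * L) ^ 2 *
          ∫ s in (0 : ℝ)..t, StringChain.dampingKernel α (t - s) * deriv (fun y => r s y) 0) ∧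
      -- `zeta y` is the unique root of `∫₀ʷ X = y`
      (∀ y w : ℝ, (∫ u in (0 : ℝ)..w, X u) = y ↔ w = zeta y) ∧
      -- `kidx N y` is the unique particle `j` with `x_j(0) ≤ y < x_{j+1}(0)`
      (∀ᶠ N : ℕ in atTop, ∀ (y : ℝ) (j : ℤ),
        (x N j 0 ≤ y ∧ y < x N (j + 1) 0) ↔ j = kidx N y) ∧
      -- convergence
      (∀ T : ℝ, 0 < T →
        TendstoUniformlyOn (fun (N : ℕ) (p : ℝ × ℝ) => x N ⌊p.2 * N / L⌋ p.1)
          (fun p : ℝ × ℝ => G p.1 p.2) atTop (Icc 0 T ×ˢ Ico 0 L)) ∧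
      (∀ T : ℝ, 0 < T →
        TendstoUniformlyOn (fun (N : ℕ) (p : ℝ × ℝ) => x N (kidx N p.2) p.1)
          (fun p : ℝ × ℝ => G p.1 (zeta p.2)) atTop (Icc 0 T ×ˢ Ico 0 L)) := by
  obtain ⟨G, r, hG, hr, hGr, hG0⟩ := StringChain.exists_isWaveSolution hL (mul_pos hω₀ hL).le hα
    hf.continuous hXV v
  have hX := hXV.contDiff_X.continuous
  obtain ⟨m, hm0, hm⟩ := StringChain.exists_pos_le_of_periodic hL hX hXV.periodic_X hXV.pos
  have hmono := StringChain.strictMono_integral hX hm0 hm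
  choose zeta hzeta using StringChain.surjective_integral hX hm0 hm
  simp only at hzeta
  have hlim : ∀ H : ℝ → ℝ → ℝ, StringChain.IsWaveSolution L (ω₀ * L) α f X V v H →
      StringChain.IsContinuumLimit L x H := fun H hH T ε hε =>
    StringChain.eventually_abs_chain_sub_lt hL hω₀ hα hX hXV.contDiff_V.continuous hXV.periodic_X
      hXV.periodic_V hH hmotion hinit hv hε
  have hcont : ∀ H : ℝ → ℝ → ℝ, StringChain.IsWaveSolution L (ω₀ * L) α f X V v H →
      ∀ t, 0 ≤ t → Continuous (H t) := fun H hH t ht => by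
    obtain ⟨-, Hz, -, -, -, hHz, -⟩ := hH.exists_partials
    exact continuous_iff_continuousAt.2 fun z => (hHz t ht z).continuousAt
  have hnear := (hlim G hG).near hL hG.contDiffOn.continuousOn
  -- A total choice: for small `N`, where no such index need exist, the value is arbitrary and only
  -- large `N` is used.
  let kidx : ℕ → ℝ → ℤ := fun N y => Classical.epsilon fun j => x N j 0 ≤ y ∧ y < x N (j + 1) 0
  have hkidx : ∀ᶠ N : ℕ in atTop, ∀ (y : ℝ) (j : ℤ),
      (x N j 0 ≤ y ∧ y < x N (j + 1) 0) ↔ j = kidx N y := by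
    filter_upwards [hmotion, hinit, eventually_gt_atTop 0] with N hN hi hN0 y j
    have hs : StrictMono fun k => x N k 0 := strictMono_int_of_lt_succ hi.ordered
    have hspec := Classical.epsilon_spec (StringChain.exists_index_of_strictMono hL hs hN0
      (fun k => hN.periodic k 0 le_rfl) y)
    refine ⟨fun hj => StringChain.index_unique_of_strictMono hs hj hspec, fun hj => ?_⟩
    rw [hj]
    exact hspec
  refine ⟨G, r, zeta, kidx, hG, fun H hH t ht z => (hlim G hG).unique hL (hlim H hH) ht
    (hcont G hG t ht) (hcont H hH t ht) z, fun t _ => hr t, fun t _ => hGr t, fun t _ => hG0 t,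
    fun y w => ?_, hkidx, fun T _ => ?_, fun T _ => ?_⟩
  · refine Iff.trans ?_ (hmono.injective.eq_iff (a := w) (b := zeta y))
    simp only [hzeta]
  · rw [Metric.tendstoUniformlyOn_iff]
    intro ε hε
    obtain ⟨d, hd, hN⟩ := hnear T hε
    filter_upwards [hN, eventually_gt_atTop 0,
      (tendsto_const_div_atTop_nhds_zero_nat L).eventually_lt_const hd] with N hN hN0 hNd p hp
    rw [dist_comm, Real.dist_eq]
    exact hN _ _ hp.1 _ (Ico_subset_Icc_self hp.2)
      ((StringChain.abs_floor_node_sub_le hL hN0 _).trans_lt hNd)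
  · rw [Metric.tendstoUniformlyOn_iff]
    intro ε hε
    obtain ⟨d, hd, hN⟩ := hnear T hε
    -- The tolerance `m d/2` at time `0` is the least change of `∫₀ᶻ X` over a distance `d/2`, and
    -- `L/N < d/2` handles the step to the next node.
    filter_upwards [hN, hkidx, (tendsto_const_div_atTop_nhds_zero_nat L).eventually_lt_const
      (half_pos hd), hlim G hG 0 (m * (d / 2)) (by positivity)] with N hN hk hNd hN0 p hp
    have hz : zeta p.2 ∈ Icc 0 L := by
      constructor
      · rw [← hmono.le_iff_le]
        simpa [hzeta] using hp.2.1
      · rw [← hmono.le_iff_le]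
        simpa [hzeta, hXV.integral_X] using hp.2.2.le
    obtain ⟨h1, h2⟩ := (hk p.2 (kidx N p.2)).2 rfl
    rw [dist_comm, Real.dist_eq]
    refine hN _ _ hp.1 _ hz ?_
    have e1 := (abs_lt.1 (hN0 (kidx N p.2) 0 ⟨le_rfl, le_rfl⟩)).1
    have e2 := (abs_lt.1 (hN0 (kidx N p.2 + 1) 0 ⟨le_rfl, le_rfl⟩)).2
    rw [hG.initial_position] at e1 e2
    have hnode : ((kidx N p.2 + 1 : ℤ) : ℝ) * L / N = kidx N p.2 * L / N + L / N := by
      push_cast; ring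
    rw [hnode] at e2
    have hy := hzeta p.2
    rw [abs_lt]
    constructor
    -- If the node lay `d` or more to the left of `zeta`, the next node would still be `d/2` to the
    -- left, and particle `kidx + 1` would start below `p.2`.
    · by_contra! hc
      have h3 : (kidx N p.2 : ℝ) * L / N + L / N ≤ zeta p.2 - d / 2 := by linarith
      have h4 := StringChain.mul_sub_le_integral_sub hX hm (h3.trans (by linarith : _ ≤ zeta p.2))
      have h5 : m * (d / 2) ≤ m * (zeta p.2 - (kidx N p.2 * L / N + L / N)) := by
        gcongr
        linarith
      linarith
    -- If the node lay `d` or more to the right, particle `kidx` itself would start above `p.2`.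
    · by_contra! hc
      have h4 := StringChain.mul_sub_le_integral_sub hX hm
        (by linarith : zeta p.2 ≤ kidx N p.2 * L / N)
      have h5 : m * d ≤ m * (kidx N p.2 * L / N - zeta p.2) := by gcongr
      nlinarith
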